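/- All rings are associative with a non-zero identity element. A ring $A$ with center $C$ is \emph{centrally essential} if for every non-zero $a\in A$ there are non-zero $c,d\in C$ with $ac=d$. A module is \emph{distributive} if its lattice of submodules is distributive, and \emph{uniserial} if any two of its submodules are comparable with respect to inclusion. A ring $A$ is \emph{right distributive} (\emph{right Noetherian}, etc.) if the right module $A_A$ has the respective property; $A$ is called distributive, uniserial, Noetherian or Artinian, without a side, if both $A_A$ and ${}_AA$ have the property. \textbf{(1)} If $A$ is a right distributive, centrally essential, finite ring, then $A\cong A_1\times\cdots\times A_n$, where each $A_i$ is a commutative uniserial finite ring; in particular, $A$ is a commutative distributive ring. Conversely, every such finite direct product is a commutative distributive finite ring. \textbf{(2)} If $A$ is a right distributive, right or left Noetherian, centrally essential ring, then $A\cong A_1\times\cdots\times A_n$, where each $A_i$ is either a (not necessarily commutative) uniserial Artinian ring or a commutative Dedekind domain (fields included); in particular, $A$ is a distributive Noetherian ring. Conversely, every finite direct product of uniserial Artinian rings and commutative Dedekind domains is a distributive Noetherian ring. Such a product need not be commutative: there exists a non-commutative uniserial Artinian centrally essential ring. -/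

import Mathlib

universe u v

/-- A module is distributive if its lattice of submodules is distributive. -/
def IsDistributiveModule (R : Type u) (M : Type v) [Ring R] [AddCommGroup M] [Module R M] : Prop :=
  ∀ X Y Z : Submodule R M, X ⊓ (Y ⊔ Z) = (X ⊓ Y) ⊔ (X ⊓ Z)

/-- A module is uniserial if any two of its submodules are comparable. -/
def IsUniserialModule (R : Type u) (M : Type v) [Ring R] [AddCommGroup M] [Module R M] : Prop :=
  ∀ X Y : Submodule R M, X ≤ Y ∨ Y ≤ X

/-- A ring is right distributive if it is distributive as a right module over itself. A right
`A`-module is a module over the opposite ring `Aᵐᵒᵖ`. -/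
def IsRightDistributive (A : Type u) [Ring A] : Prop :=
  IsDistributiveModule Aᵐᵒᵖ A

/-- A ring is distributive if it is so as a right and as a left module over itself. -/
def IsDistributiveRing (A : Type u) [Ring A] : Prop :=
  IsDistributiveModule Aᵐᵒᵖ A ∧ IsDistributiveModule A A

/-- A ring is uniserial if it is so as a right and as a left module over itself. -/
def IsUniserialRing (A : Type u) [Ring A] : Prop :=
  IsUniserialModule Aᵐᵒᵖ A ∧ IsUniserialModule A A

def IsRightNoetherian (A : Type u) [Ring A] : Prop :=
  IsNoetherian Aᵐᵒᵖ A

def IsLeftNoetherian (A : Type u) [Ring A] : Prop :=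
  IsNoetherian A A

def IsTwoSidedNoetherian (A : Type u) [Ring A] : Prop :=
  IsRightNoetherian A ∧ IsLeftNoetherian A

def IsTwoSidedArtinian (A : Type u) [Ring A] : Prop :=
  IsArtinian Aᵐᵒᵖ A ∧ IsArtinian A A

/-- A ring is centrally essential if every non-zero `a` satisfies `a * c = d` for some non-zero
central elements `c` and `d`. -/
def IsCentrallyEssential (A : Type u) [Ring A] : Prop :=
  ∀ a : A, a ≠ 0 →
    ∃ c ∈ Subring.center A, ∃ d ∈ Subring.center A, c ≠ 0 ∧ d ≠ 0 ∧ a * c = d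

def IsCommutativeRing (A : Type u) [Ring A] : Prop :=
  ∀ a b : A, a * b = b * a

/-- The ring is commutative, and with its given operations it is a Dedekind domain. -/
def IsCommutativeDedekindDomain (A : Type u) [Ring A] : Prop :=
  ∃ h : IsCommutativeRing A,
    @IsDedekindDomain A { (inferInstance : Ring A) with mul_comm := h }

def IsUniserialArtinian (A : Type u) [Ring A] : Prop :=
  IsUniserialRing A ∧ IsTwoSidedArtinian A

/-- `A` is isomorphic to a direct product of finitely many non-zero rings with property `P`. -/
def IsFiniteProductOf (P : ∀ (R : Type u) [Ring R], Prop) (A : Type u) [Ring A] : Prop :=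
  ∃ (n : ℕ) (R : Fin n → Type u) (_ : ∀ i, Ring (R i)),
    (∀ i, Nontrivial (R i) ∧ P (R i)) ∧ Nonempty (A ≃+* (∀ i, R i))

/-- Finite direct products of non-zero commutative uniserial finite rings. -/
def IsProductOfCommutativeUniserialFinite (A : Type u) [Ring A] : Prop :=
  IsFiniteProductOf (fun R _ => IsCommutativeRing R ∧ IsUniserialRing R ∧ Finite R) A

/-- Finite direct products of non-zero rings, each of which is a uniserial Artinian ring or a
commutative Dedekind domain. -/
def IsProductOfUniserialArtinianOrDedekind (A : Type u) [Ring A] : Prop :=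
  IsFiniteProductOf (fun R _ => IsUniserialArtinian R ∨ IsCommutativeDedekindDomain R) A

open MulOpposite

/-! Distributivity is used elementwise: for all m, n some a has m a ∈ nA and n (1 - a) ∈ mA. Central
essentiality makes idempotents central, and the Noetherian hypothesis, used mostly on sets of
central elements, where the side is immaterial (`IsCentrallyNoetherian`), splits A into finitely
many rings whose only idempotents are 0 and 1.

Such a ring admits Fitting arguments. If xA ∩ yA = 0 for all x, y in two finite central sets,
distributivity gives b killing one set while 1 - b kills the other
(`IsRightDistributive.exists_separating`); chain conditions make a power of b idempotent, or b (1 -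
b) nilpotent. So a central element is nilpotent or regular. Without nonzero central nilpotents, A is
a commutative Noetherian distributive domain, hence Dedekind. Otherwise the central elements killed
by all central nilpotents form an ideal that meets enough of A to run Fitting again: every element
is nilpotent or a unit. Then right ideals form a chain and are two-sided, the nonunits are pA with p
nilpotent, and a nonzero central nonunit forces pA = Ap. Powers of p generate all one-sided ideals,
so A is uniserial Artinian.

If A is finite with residue field of q elements, commutators with t ^ (q ^ m) sink into ever higher
powers of p. So each residue class has a central representative, A = C + pA, and all commutators lie
in every p ^ m A, hence vanish. Over an infinite residue field this fails: two independent
derivations twist the dual numbers into a counterexample. -/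

/-! ### Elementwise criteria for distributive and uniserial modules -/

theorem isDistributiveModule_iff {R : Type u} {M : Type v} [Ring R] [AddCommGroup M] [Module R M] :
    IsDistributiveModule R M ↔
      ∀ m n : M, ∃ a x y : R, a • m = x • n ∧ (1 - a) • n = y • m := by
  constructor
  · intro h m n
    have h1 := h (Submodule.span R {m + n}) (Submodule.span R {m}) (Submodule.span R {n})
    have h2 : m + n ∈ Submodule.span R {m + n} ⊓ (Submodule.span R {m} ⊔ Submodule.span R {n}) :=
      ⟨Submodule.mem_span_singleton_self _,
        Submodule.add_mem_sup (Submodule.mem_span_singleton_self _)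
          (Submodule.mem_span_singleton_self _)⟩
    rw [h1] at h2
    obtain ⟨p, ⟨hp1, hp2⟩, q, ⟨hq1, hq2⟩, hpq⟩ := Submodule.mem_sup.1 h2
    obtain ⟨x, rfl⟩ := Submodule.mem_span_singleton.1 hp1
    obtain ⟨y, rfl⟩ := Submodule.mem_span_singleton.1 hq1
    obtain ⟨s, hs⟩ := Submodule.mem_span_singleton.1 hp2
    obtain ⟨t, ht⟩ := Submodule.mem_span_singleton.1 hq2
    -- Here x (m + n) = s m, y (m + n) = t n and these add up to m + n. So a = 1 - x works: x n = x
    -- (m + n) - x m = (s - x) m.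
    refine ⟨1 - x, t - y - (1 - x - y), s - x, ?_, ?_⟩
    · have e : (1 - x) • m = (y • (m + n) - y • n) + ((m + n) - (x • (m + n) + y • (m + n)) -
          (1 - x - y) • n) := by simp only [smul_add, sub_smul, one_smul]; abel
      rw [e, hpq, ← ht]; simp only [sub_smul, one_smul]; abel
    · have e : (1 - (1 - x)) • n = x • (m + n) - x • m := by
        simp only [smul_add, sub_smul, one_smul]; abel
      rw [e, ← hs, sub_smul]
  · intro h X Y Z
    refine le_antisymm ?_ (sup_le (inf_le_inf_left _ le_sup_left) (inf_le_inf_left _ le_sup_right))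
    rintro w ⟨hw, hw'⟩
    obtain ⟨y, hy, z, hz, rfl⟩ := Submodule.mem_sup.1 hw'
    obtain ⟨a, s, t, h1, h2⟩ := h y z
    have e : y + z = (1 - a) • (y + z) + a • (y + z) := by rw [sub_smul, one_smul]; abel
    rw [e]
    refine Submodule.add_mem_sup ⟨X.smul_mem _ hw, ?_⟩ ⟨X.smul_mem _ hw, ?_⟩
    · change (1 - a) • (y + z) ∈ Y
      rw [smul_add, h2]
      exact Y.add_mem (Y.smul_mem _ hy) (Y.smul_mem _ hy)
    · change a • (y + z) ∈ Z
      rw [smul_add, h1]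
      exact Z.add_mem (Z.smul_mem _ hz) (Z.smul_mem _ hz)

theorem isRightDistributive_iff {A : Type u} [Ring A] :
    IsRightDistributive A ↔ ∀ m n : A, ∃ a x y : A, m * a = n * x ∧ n * (1 - a) = m * y := by
  rw [IsRightDistributive, isDistributiveModule_iff]
  refine forall₂_congr fun m n => ⟨?_, ?_⟩
  · rintro ⟨a, x, y, h1, h2⟩
    exact ⟨unop a, unop x, unop y, h1, h2⟩
  · rintro ⟨a, x, y, h1, h2⟩
    exact ⟨op a, op x, op y, h1, h2⟩

theorem isLeftDistributive_iff {A : Type u} [Ring A] :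
    IsDistributiveModule A A ↔ ∀ m n : A, ∃ a x y : A, a * m = x * n ∧ (1 - a) * n = y * m :=
  isDistributiveModule_iff

theorem IsUniserialModule.isDistributiveModule {R : Type u} {M : Type v} [Ring R] [AddCommGroup M]
    [Module R M] (h : IsUniserialModule R M) : IsDistributiveModule R M := by
  rw [isDistributiveModule_iff]
  intro m n
  rcases h (Submodule.span R {m}) (Submodule.span R {n}) with h | h
  · obtain ⟨x, hx⟩ := Submodule.mem_span_singleton.1 (h (Submodule.mem_span_singleton_self m))
    exact ⟨1, x, 0, by simp [hx], by simp⟩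
  · obtain ⟨x, hx⟩ := Submodule.mem_span_singleton.1 (h (Submodule.mem_span_singleton_self n))
    exact ⟨0, 0, x, by simp, by simp [hx]⟩

theorem isUniserialModule_iff {R : Type u} {M : Type v} [Ring R] [AddCommGroup M] [Module R M] :
    IsUniserialModule R M ↔ ∀ m n : M, (∃ x : R, m = x • n) ∨ ∃ x : R, n = x • m := by
  constructor
  · intro h m n
    rcases h (Submodule.span R {m}) (Submodule.span R {n}) with h | h
    · obtain ⟨x, hx⟩ := Submodule.mem_span_singleton.1 (h (Submodule.mem_span_singleton_self m))
      exact Or.inl ⟨x, hx.symm⟩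
    · obtain ⟨x, hx⟩ := Submodule.mem_span_singleton.1 (h (Submodule.mem_span_singleton_self n))
      exact Or.inr ⟨x, hx.symm⟩
  · intro h X Y
    by_contra! hXY
    obtain ⟨x, hx, hxY⟩ := SetLike.not_le_iff_exists.1 hXY.1
    obtain ⟨y, hy, hyX⟩ := SetLike.not_le_iff_exists.1 hXY.2
    rcases h x y with ⟨a, rfl⟩ | ⟨a, rfl⟩
    · exact hxY (Y.smul_mem _ hy)
    · exact hyX (X.smul_mem _ hx)

/-! ### Quotients, products and opposite rings -/

theorem IsRightDistributive.of_surjective {A B : Type*} [Ring A] [Ring B]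
    (h : IsRightDistributive A) (f : A →+* B) (hf : Function.Surjective f) :
    IsRightDistributive B := by
  rw [isRightDistributive_iff] at h ⊢
  intro m n
  obtain ⟨m, rfl⟩ := hf m
  obtain ⟨n, rfl⟩ := hf n
  obtain ⟨a, x, y, h1, h2⟩ := h m n
  exact ⟨f a, f x, f y, by simp [← map_mul, h1], by simp [← map_mul, ← h2, mul_sub]⟩

theorem isDistributiveModule_of_surjective {A B : Type*} [Ring A] [Ring B]
    (h : IsDistributiveModule A A) (f : A →+* B) (hf : Function.Surjective f) :
    IsDistributiveModule B B := by
  rw [isLeftDistributive_iff] at h ⊢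
  intro m n
  obtain ⟨m, rfl⟩ := hf m
  obtain ⟨n, rfl⟩ := hf n
  obtain ⟨a, x, y, h1, h2⟩ := h m n
  exact ⟨f a, f x, f y, by simp [← map_mul, h1], by simp [← map_mul, ← h2, sub_mul]⟩

theorem IsDistributiveRing.pi {ι : Type*} {R : ι → Type*} [∀ i, Ring (R i)]
    (h : ∀ i, IsDistributiveRing (R i)) : IsDistributiveRing (∀ i, R i) := by
  refine ⟨isRightDistributive_iff.2 fun m n => ?_, isLeftDistributive_iff.2 fun m n => ?_⟩
  · choose a x y h1 h2 using fun i => isRightDistributive_iff.1 (h i).1 (m i) (n i)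
    exact ⟨a, x, y, funext h1, funext h2⟩
  · choose a x y h1 h2 using fun i => isLeftDistributive_iff.1 (h i).2 (m i) (n i)
    exact ⟨a, x, y, funext h1, funext h2⟩

theorem IsDistributiveRing.of_surjective {A B : Type*} [Ring A] [Ring B]
    (h : IsDistributiveRing A) (f : A →+* B) (hf : Function.Surjective f) :
    IsDistributiveRing B :=
  ⟨IsRightDistributive.of_surjective h.1 f hf, isDistributiveModule_of_surjective h.2 f hf⟩

theorem IsUniserialRing.isDistributiveRing {A : Type*} [Ring A] (h : IsUniserialRing A) :
    IsDistributiveRing A :=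
  ⟨h.1.isDistributiveModule, h.2.isDistributiveModule⟩

/-- Taking opposites identifies `A` as a right module with `Aᵐᵒᵖ` as a left module. -/
def opRightLinearEquiv (A : Type*) [Ring A] : A ≃ₗ[Aᵐᵒᵖ] Aᵐᵒᵖ where
  toFun := op
  invFun := unop
  left_inv _ := rfl
  right_inv _ := rfl
  map_add' _ _ := rfl
  map_smul' _ _ := rfl

theorem isRightNoetherian_iff {A : Type*} [Ring A] :
    IsRightNoetherian A ↔ IsNoetherianRing Aᵐᵒᵖ :=
  ⟨fun h => have : IsNoetherian Aᵐᵒᵖ A := h; isNoetherian_of_linearEquiv (opRightLinearEquiv A),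
    fun _ => isNoetherian_of_linearEquiv (opRightLinearEquiv A).symm⟩

theorem isArtinian_op_iff {A : Type*} [Ring A] :
    IsArtinian Aᵐᵒᵖ A ↔ IsArtinianRing Aᵐᵒᵖ :=
  (opRightLinearEquiv A).isArtinian_iff

theorem IsRightNoetherian.of_surjective {A B : Type*} [Ring A] [Ring B]
    (h : IsRightNoetherian A) (f : A →+* B) (hf : Function.Surjective f) :
    IsRightNoetherian B := by
  rw [isRightNoetherian_iff] at h ⊢
  refine isNoetherianRing_of_surjective _ _ (RingHom.op f) fun b => ?_
  obtain ⟨a, ha⟩ := hf (unop b)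
  exact ⟨op a, by simp [ha]⟩

theorem IsLeftNoetherian.of_surjective {A B : Type*} [Ring A] [Ring B]
    (h : IsLeftNoetherian A) (f : A →+* B) (hf : Function.Surjective f) :
    IsLeftNoetherian B :=
  @isNoetherianRing_of_surjective _ _ _ _ f hf h

theorem IsTwoSidedNoetherian.pi {ι : Type*} [Finite ι] {R : ι → Type*} [∀ i, Ring (R i)]
    (h : ∀ i, IsTwoSidedNoetherian (R i)) : IsTwoSidedNoetherian (∀ i, R i) := by
  have h1 : ∀ i, IsNoetherianRing (R i)ᵐᵒᵖ := fun i => isRightNoetherian_iff.1 (h i).1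
  have h2 : ∀ i, IsNoetherianRing (R i) := fun i => (h i).2
  refine ⟨isRightNoetherian_iff.2 ?_, ?_⟩
  · exact isNoetherianRing_of_ringEquiv _ (RingEquiv.piMulOpposite R).symm
  · exact inferInstanceAs (IsNoetherianRing (∀ i, R i))

theorem IsTwoSidedArtinian.isTwoSidedNoetherian {A : Type*} [Ring A] (h : IsTwoSidedArtinian A) :
    IsTwoSidedNoetherian A := by
  have h1 : IsArtinianRing Aᵐᵒᵖ := isArtinian_op_iff.1 h.1
  have h2 : IsArtinianRing A := h.2
  exact ⟨isRightNoetherian_iff.2 inferInstance, inferInstanceAs (IsNoetherianRing A)⟩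

/-! ### Commutative rings -/

theorem IsCommutativeRing.isDistributiveRing {A : Type*} [Ring A] (hc : IsCommutativeRing A)
    (h : IsRightDistributive A) : IsDistributiveRing A := by
  refine ⟨h, isLeftDistributive_iff.2 fun m n => ?_⟩
  obtain ⟨a, x, y, h1, h2⟩ := isRightDistributive_iff.1 h m n
  exact ⟨a, x, y, by rw [hc a, h1, hc n], by rw [hc _ n, h2, hc m]⟩

theorem IsCommutativeRing.isTwoSidedNoetherian {A : Type*} [Ring A] (hc : IsCommutativeRing A)
    (h : IsLeftNoetherian A) : IsTwoSidedNoetherian A := by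
  have h' : IsNoetherianRing A := h
  refine ⟨isRightNoetherian_iff.2 ?_, h⟩
  exact isNoetherianRing_of_surjective A Aᵐᵒᵖ
    ((RingHom.id A).toOpposite fun x y => hc x y) fun b => ⟨unop b, rfl⟩

theorem IsCommutativeRing.isLeftNoetherian {A : Type*} [Ring A] (hc : IsCommutativeRing A)
    (h : IsRightNoetherian A) : IsLeftNoetherian A := by
  have h' : IsNoetherianRing Aᵐᵒᵖ := isRightNoetherian_iff.1 h
  exact isNoetherianRing_of_surjective Aᵐᵒᵖ A
    ((RingHom.id A).fromOpposite fun x y => hc x y) fun b => ⟨op b, rfl⟩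

/-- The a with m a ∈ (n) and the b with n b ∈ (m) form two ideals. Were their sum inside a maximal
P, the valuation ring at P would make one of m, n divide the other, and clearing denominators would
give an element of the sum outside P. -/
theorem isRightDistributive_of_isDedekindDomain {A : Type*} [CommRing A] [IsDedekindDomain A] :
    IsRightDistributive A := by
  rw [isRightDistributive_iff]
  intro m n
  let I : Ideal A :=
    Submodule.comap (LinearMap.mulLeft A m) (Ideal.span {n}) ⊔
      Submodule.comap (LinearMap.mulLeft A n) (Ideal.span {m})
  have hI : I = ⊤ := by
    by_contra hne
    obtain ⟨P, hP, hIP⟩ := Ideal.exists_le_maximal I hne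
    have hp := hP.isPrime
    have : IsDedekindDomain (Localization.AtPrime P) :=
      IsLocalization.isDedekindDomain A P.primeCompl_le_nonZeroDivisors _
    have hv : ValuationRing (Localization.AtPrime P) :=
      ((tfae_of_isNoetherianRing_of_isLocalRing_of_isDomain (Localization.AtPrime P)).out 2 1).1
        this
    have key : ∀ m n : A, algebraMap A (Localization.AtPrime P) m ∣ algebraMap A _ n →
        ∃ s ∉ P, n * s ∈ Ideal.span {m} := by
      rintro m n ⟨c, hc⟩
      obtain ⟨⟨x, s⟩, rfl⟩ := IsLocalization.mk'_surjective P.primeCompl c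
      rw [IsLocalization.mul_mk'_eq_mk'_of_mul, IsLocalization.eq_mk'_iff_mul_eq, ← map_mul] at hc
      have := IsLocalization.injective (Localization.AtPrime P) P.primeCompl_le_nonZeroDivisors hc
      exact ⟨s, s.2, Ideal.mem_span_singleton.2 ⟨x, this⟩⟩
    rcases ValuationRing.dvd_total (algebraMap A (Localization.AtPrime P) m)
      (algebraMap A _ n) with h | h
    · obtain ⟨s, hs, h⟩ := key _ _ h
      exact hs (hIP (Ideal.mem_sup_right h))
    · obtain ⟨s, hs, h⟩ := key _ _ h
      exact hs (hIP (Ideal.mem_sup_left h))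
  have h1 : (1 : A) ∈ I := hI ▸ Submodule.mem_top
  obtain ⟨a, ha, b, hb, hab⟩ := Submodule.mem_sup.1 h1
  obtain ⟨x, hx⟩ := Ideal.mem_span_singleton.1 ha
  obtain ⟨y, hy⟩ := Ideal.mem_span_singleton.1 hb
  exact ⟨a, x, y, hx, by rw [← hab, add_sub_cancel_left]; exact hy⟩

/-- One of a, 1 - a lies outside P, so the criterion becomes total divisibility in the localization:
a Noetherian valuation ring, not a field, hence a DVR. -/
theorem isDedekindDomain_of_isRightDistributive {A : Type*} [CommRing A] [IsDomain A]
    [IsNoetherianRing A] (h : IsRightDistributive A) : IsDedekindDomain A := by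
  rw [isRightDistributive_iff] at h
  have : IsDedekindDomainDvr A := by
    refine { is_dvr_at_nonzero_prime := fun P hP hp => ?_ }
    have hnf := IsLocalization.AtPrime.not_isField A hP (Localization.AtPrime P)
    refine ((IsDiscreteValuationRing.TFAE (Localization.AtPrime P) hnf).out 0 1).2 ?_
    rw [ValuationRing.iff_dvd_total]
    have hu : ∀ a ∉ P, IsUnit (algebraMap A (Localization.AtPrime P) a) := fun a ha =>
      IsLocalization.map_units _ (⟨a, ha⟩ : P.primeCompl)
    have hm : ∀ m n : A, algebraMap A (Localization.AtPrime P) m ∣ algebraMap A _ n ∨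
        algebraMap A (Localization.AtPrime P) n ∣ algebraMap A _ m := by
      intro m n
      obtain ⟨a, x, y, h1, h2⟩ := h m n
      by_cases ha : a ∈ P
      · have ha' : 1 - a ∉ P := fun hb => hp.ne_top ((Ideal.eq_top_iff_one _).2 (by
          simpa using P.add_mem hb ha))
        refine Or.inl ((hu _ ha').dvd_mul_right.1 ⟨algebraMap A _ y, ?_⟩)
        rw [← map_mul, ← map_mul, h2]
      · refine Or.inr ((hu _ ha).dvd_mul_right.1 ⟨algebraMap A _ x, ?_⟩)
        rw [← map_mul, ← map_mul, h1]
    refine ⟨fun a b => ?_⟩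
    obtain ⟨⟨x, s⟩, rfl⟩ := IsLocalization.mk'_surjective P.primeCompl a
    obtain ⟨⟨y, t⟩, rfl⟩ := IsLocalization.mk'_surjective P.primeCompl b
    have hs := hu s s.2
    have ht := hu t t.2
    have := hm x y
    rwa [← IsLocalization.mk'_spec (Localization.AtPrime P) x s,
      ← IsLocalization.mk'_spec (Localization.AtPrime P) y t, hs.mul_right_dvd, ht.dvd_mul_right,
      ht.mul_right_dvd, hs.dvd_mul_right] at this
  infer_instance

theorem IsCommutativeDedekindDomain.isDistributiveRing {A : Type*} [Ring A]
    (h : IsCommutativeDedekindDomain A) : IsDistributiveRing A := by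
  obtain ⟨hc, hd⟩ := h
  refine hc.isDistributiveRing ?_
  let _ : CommRing A := { (inferInstance : Ring A) with mul_comm := hc }
  exact @isRightDistributive_of_isDedekindDomain A _ hd

theorem IsCommutativeDedekindDomain.isTwoSidedNoetherian {A : Type*} [Ring A]
    (h : IsCommutativeDedekindDomain A) : IsTwoSidedNoetherian A := by
  obtain ⟨hc, hd⟩ := h
  refine hc.isTwoSidedNoetherian ?_
  let _ : CommRing A := { (inferInstance : Ring A) with mul_comm := hc }
  have : IsDedekindDomain A := hd
  exact (inferInstance : IsNoetherianRing A)

/-! ### The converse implications for products -/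

theorem IsProductOfUniserialArtinianOrDedekind.isDistributiveRing_and_isTwoSidedNoetherian
    {A : Type u} [Ring A]
    (h : IsProductOfUniserialArtinianOrDedekind A) :
    IsDistributiveRing A ∧ IsTwoSidedNoetherian A := by
  obtain ⟨n, R, _, hR, ⟨e⟩⟩ := h
  constructor
  · refine IsDistributiveRing.of_surjective (IsDistributiveRing.pi fun i => ?_)
      (e.symm : (∀ i, R i) →+* A) e.symm.surjective
    rcases (hR i).2 with h | h
    · exact h.1.isDistributiveRing
    · exact h.isDistributiveRing
  · have h : IsTwoSidedNoetherian (∀ i, R i) := by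
      refine IsTwoSidedNoetherian.pi fun i => ?_
      rcases (hR i).2 with h | h
      · exact h.2.isTwoSidedNoetherian
      · exact h.isTwoSidedNoetherian
    exact ⟨h.1.of_surjective (e.symm : (∀ i, R i) →+* A) e.symm.surjective,
      h.2.of_surjective (e.symm : (∀ i, R i) →+* A) e.symm.surjective⟩

theorem IsProductOfCommutativeUniserialFinite.isCommutativeRing_and_isDistributiveRing
    {A : Type u} [Ring A]
    (h : IsProductOfCommutativeUniserialFinite A) :
    IsCommutativeRing A ∧ IsDistributiveRing A ∧ Finite A := by
  obtain ⟨n, R, _, hR, ⟨e⟩⟩ := h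
  refine ⟨fun a b => e.injective (funext fun i => ?_), ?_, ?_⟩
  · rw [map_mul, map_mul]
    exact (hR i).2.1 _ _
  · exact IsDistributiveRing.of_surjective
      (IsDistributiveRing.pi fun i => (hR i).2.2.1.isDistributiveRing)
      (e.symm : (∀ i, R i) →+* A) e.symm.surjective
  · have := fun i => (hR i).2.2.2
    exact Finite.of_equiv _ e.symm.toEquiv

/-! ### Centrally essential rings -/

theorem mul_comm_of_mem_center {A : Type*} [Ring A] {c : A} (hc : c ∈ Subring.center A) (a : A) :
    c * a = a * c :=
  (Subring.mem_center_iff.1 hc a).symm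

/-- A nonzero central multiple d of e x f would satisfy d = e d = d e = 0. -/
theorem IsCentrallyEssential.mul_eq_zero_of_isIdempotentElem {A : Type*} [Ring A]
    (hA : IsCentrallyEssential A) {e f : A} (he : e * e = e) (hfe : f * e = 0) (x : A) :
    e * x * f = 0 := by
  by_contra h
  obtain ⟨c, hc, d, hd, -, hd0, h⟩ := hA _ h
  apply hd0
  have h1 : e * d = d := by rw [← h]; simp only [← mul_assoc, he]
  have h2 : d * e = 0 := by
    rw [← h, mul_assoc, mul_comm_of_mem_center hc, mul_assoc (e * x), ← mul_assoc f, hfe]; simp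
  rw [← h1, ← mul_comm_of_mem_center hd, h2]

theorem IsCentrallyEssential.mem_center_of_isIdempotentElem {A : Type*} [Ring A]
    (hA : IsCentrallyEssential A) {e : A} (he : e * e = e) : e ∈ Subring.center A := by
  rw [Subring.mem_center_iff]
  intro x
  have h1 := hA.mul_eq_zero_of_isIdempotentElem he (f := 1 - e) (by rw [sub_mul, he]; simp) x
  have h2 := hA.mul_eq_zero_of_isIdempotentElem (e := 1 - e) (f := e)
    (by simp [mul_sub, sub_mul, he]) (by rw [mul_sub, he]; simp) x
  have h3 : e * x = e * x * e := by rw [mul_sub, mul_one, sub_eq_zero] at h1; exact h1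
  have h4 : x * e = e * x * e := by rw [sub_mul, sub_mul, one_mul, sub_eq_zero] at h2; exact h2
  rw [h3, h4]

/-- Every set of central elements lies in the ideal generated by a finite subset. -/
def IsCentrallyNoetherian (A : Type*) [Ring A] : Prop :=
  ∀ S : Set A, S ⊆ Subring.center A → ∃ T : Finset A, (T : Set A) ⊆ S ∧ S ⊆ Ideal.span (T : Set A)

theorem IsLeftNoetherian.isCentrallyNoetherian {A : Type*} [Ring A] (h : IsLeftNoetherian A) :
    IsCentrallyNoetherian A := by
  intro S _
  have h' : IsNoetherian A A := h
  obtain ⟨T, hT, h⟩ := Submodule.fg_span_iff_fg_span_finset_subset S |>.1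
    (IsNoetherian.noetherian (Submodule.span A S))
  exact ⟨T, hT, fun x hx => by
    change x ∈ Submodule.span A (T : Set A)
    rw [← h]; exact Submodule.subset_span hx⟩

theorem IsRightNoetherian.isCentrallyNoetherian {A : Type*} [Ring A] (h : IsRightNoetherian A) :
    IsCentrallyNoetherian A := by
  intro S hS
  have h' : IsNoetherian Aᵐᵒᵖ A := h
  obtain ⟨T, hT, h⟩ := Submodule.fg_span_iff_fg_span_finset_subset S |>.1
    (IsNoetherian.noetherian (Submodule.span Aᵐᵒᵖ S))
  refine ⟨T, hT, fun x hx => ?_⟩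
  have hx' : x ∈ Submodule.span Aᵐᵒᵖ (T : Set A) := by
    rw [← h]; exact Submodule.subset_span hx
  refine Submodule.span_induction (fun y hy => Ideal.subset_span hy) (Ideal.zero_mem _)
    (fun _ _ _ _ => Ideal.add_mem _) (fun a y _ hy => ?_) hx'
  change y * unop a ∈ _
  refine Submodule.span_induction (p := fun y _ => y * unop a ∈ Ideal.span (T : Set A))
    (fun z hz => ?_) (by simp) (fun y z _ _ hy hz => ?_) (fun b y _ hy => ?_) hy
  · rw [mul_comm_of_mem_center (hS (hT hz))]
    exact Ideal.mul_mem_left _ _ (Ideal.subset_span hz)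
  · rw [add_mul]
    exact Ideal.add_mem _ hy hz
  · rw [smul_eq_mul, mul_assoc]
    exact Ideal.mul_mem_left _ _ hy

theorem mul_eq_zero_of_mem_span {A : Type*} [Ring A] {T : Set A} {b x : A}
    (h : ∀ t ∈ T, t * b = 0) (hx : x ∈ Ideal.span T) : x * b = 0 := by
  refine Submodule.span_induction (p := fun x _ => x * b = 0) h (zero_mul _)
    (fun x y _ _ hx hy => by rw [add_mul, hx, hy, add_zero])
    (fun a x _ hx => by rw [smul_eq_mul, mul_assoc, hx, mul_zero]) hx

/-- The central elements killing some f n lie in the left ideal of finitely many of them, and a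
single late f n is killed by those. -/
theorem IsCentrallyNoetherian.exists_ann_stable {A : Type*} [Ring A]
    (hN : IsCentrallyNoetherian A) (f : ℕ → A)
    (hf : ∀ n, ∀ s ∈ Subring.center A, s * f n = 0 → s * f (n + 1) = 0) :
    ∃ n, ∀ m, ∀ s ∈ Subring.center A, s * f m = 0 → s * f n = 0 := by
  obtain ⟨T, hT, hS⟩ := hN {s | s ∈ Subring.center A ∧ ∃ n, s * f n = 0} fun s hs => hs.1
  have mono : ∀ s ∈ Subring.center A, ∀ n m, n ≤ m → s * f n = 0 → s * f m = 0 := by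
    intro s hs n m hnm h
    induction m, hnm using Nat.le_induction with
    | base => exact h
    | succ m _ ih => exact hf m s hs ih
  have hT' : ∀ t, ∃ n, t ∈ T → t * f n = 0 := fun t => by
    by_cases ht : t ∈ T
    · obtain ⟨n, hn⟩ := (hT ht).2
      exact ⟨n, fun _ => hn⟩
    · exact ⟨0, fun h => absurd h ht⟩
  choose n hn using hT'
  refine ⟨T.sup n, fun m s hs h => ?_⟩
  exact mul_eq_zero_of_mem_span (T := (T : Set A))
    (fun t ht => mono t (hT ht).1 _ _ (Finset.le_sup (f := n) ht) (hn t ht)) (hS ⟨hs, m, h⟩)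

/-- Here x need not be central, so the actual one-sided condition is needed. The kernels are
two-sided ideals, so either side serves. -/
theorem exists_ker_pow_stable {A : Type*} [Ring A] (h : IsRightNoetherian A ∨ IsLeftNoetherian A)
    {c : A} (hc : c ∈ Subring.center A) :
    ∃ n, ∀ m x, c ^ m * x = 0 → c ^ n * x = 0 := by
  have hcn : ∀ n, c ^ n ∈ Subring.center A := fun n => pow_mem hc n
  have hle : ∀ {n m : ℕ} {x : A}, n ≤ m → c ^ n * x = 0 → c ^ m * x = 0 := by
    intro n m x hnm hx
    rw [← Nat.sub_add_cancel hnm, pow_add, mul_assoc, hx, mul_zero]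
  rcases h with h | h
  · have h' : IsNoetherian Aᵐᵒᵖ A := h
    let f : ℕ →o Submodule Aᵐᵒᵖ A :=
      { toFun := fun n =>
          { carrier := {x | c ^ n * x = 0}
            add_mem' := fun {a b} ha hb => by
              simp only [Set.mem_ofPred_eq] at *; rw [mul_add, ha, hb, add_zero]
            zero_mem' := mul_zero _
            smul_mem' := fun a x hx => by
              change c ^ n * (x * unop a) = 0
              rw [← mul_assoc, show c ^ n * x = 0 from hx, zero_mul] }
        monotone' := fun n m hnm x hx => hle hnm hx }
    obtain ⟨n, hn⟩ := monotone_stabilizes_iff_noetherian.2 h' f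
    refine ⟨n, fun m x hx => ?_⟩
    have : x ∈ f (max n m) := hle (le_max_right _ _) hx
    rw [← hn _ (le_max_left _ _)] at this
    exact this
  · have h' : IsNoetherian A A := h
    let f : ℕ →o Submodule A A :=
      { toFun := fun n =>
          { carrier := {x | c ^ n * x = 0}
            add_mem' := fun {a b} ha hb => by
              simp only [Set.mem_ofPred_eq] at *; rw [mul_add, ha, hb, add_zero]
            zero_mem' := mul_zero _
            smul_mem' := fun a x hx => by
              change c ^ n * (a * x) = 0
              rw [← mul_assoc, mul_comm_of_mem_center (hcn n), mul_assoc,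
                show c ^ n * x = 0 from hx, mul_zero] }
        monotone' := fun n m hnm x hx => hle hnm hx }
    obtain ⟨n, hn⟩ := monotone_stabilizes_iff_noetherian.2 h' f
    refine ⟨n, fun m x hx => ?_⟩
    have : x ∈ f (max n m) := hle (le_max_right _ _) hx
    rw [← hn _ (le_max_left _ _)] at this
    exact this

/-! ### Separating central elements -/

theorem exists_forall_mul_eq_zero {A : Type*} [Ring A] (X : Finset A) (Y : Set A)
    (hX : ∀ x ∈ X, x ∈ Subring.center A) (hY : ∀ y ∈ Y, y ∈ Subring.center A)
    (h : ∀ x ∈ X, ∃ b, x * b = 0 ∧ ∀ y ∈ Y, y * (1 - b) = 0) :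
    ∃ b, (∀ x ∈ X, x * b = 0) ∧ ∀ y ∈ Y, y * (1 - b) = 0 := by
  classical
  induction X using Finset.induction_on with
  | empty => exact ⟨1, by simp, by simp⟩
  | insert x X hx ih =>
    obtain ⟨b, hb, hb'⟩ := ih (fun z hz => hX z (Finset.mem_insert_of_mem hz))
      fun z hz => h z (Finset.mem_insert_of_mem hz)
    obtain ⟨b₁, h₁, h₁'⟩ := h x (Finset.mem_insert_self _ _)
    refine ⟨b * b₁, fun z hz => ?_, fun y hy => ?_⟩
    · rcases Finset.mem_insert.1 hz with rfl | hz
      · rw [← mul_assoc, mul_comm_of_mem_center (hX _ (Finset.mem_insert_self _ _)), mul_assoc, h₁,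
          mul_zero]
      · rw [← mul_assoc, hb z hz, zero_mul]
    · have : y * (1 - b * b₁) = y * (1 - b) + b * (y * (1 - b₁)) := by
        rw [← mul_assoc b, ← mul_comm_of_mem_center (hY y hy) b]; noncomm_ring
      rw [this, hb' y hy, h₁' y hy, mul_zero, add_zero]

/-- For one pair, the criterion puts x a and y (1 - a) in xA ∩ yA = 0. Products of the resulting
elements handle finite sets, centrality letting them pass each other. -/
theorem IsRightDistributive.exists_separating {A : Type*} [Ring A] (hd : IsRightDistributive A)
    (X Y : Finset A) (hX : ∀ x ∈ X, x ∈ Subring.center A) (hY : ∀ y ∈ Y, y ∈ Subring.center A)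
    (h : ∀ x ∈ X, ∀ y ∈ Y, ∀ w w', x * w = y * w' → x * w = 0) :
    ∃ b, (∀ x ∈ X, x * b = 0) ∧ ∀ y ∈ Y, y * (1 - b) = 0 := by
  refine exists_forall_mul_eq_zero X Y hX hY fun x hx => ?_
  obtain ⟨b, hb, hb'⟩ := exists_forall_mul_eq_zero Y {x} hY (by simpa using hX x hx) fun y hy => by
    obtain ⟨a, w, w', h1, h2⟩ := isRightDistributive_iff.1 hd x y
    refine ⟨1 - a, ?_, ?_⟩
    · rw [h2]; exact h x hx y hy _ _ h2.symm
    · simpa using h x hx y hy _ _ h1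
  exact ⟨1 - b, hb' x rfl, by simpa using hb⟩

/-! ### Indecomposable rings -/

theorem isUnit_or_isUnit_one_sub_of_isNilpotent {A : Type*} [Ring A]
    (hI : ∀ e : A, e * e = e → e = 0 ∨ e = 1) {b : A} (hb : IsNilpotent (b * (1 - b))) :
    IsUnit b ∨ IsUnit (1 - b) := by
  obtain ⟨k, hk⟩ := hb
  have hk : (b * (1 - b)) ^ (k + 1) = 0 := by rw [pow_succ, hk, zero_mul]
  set m := k + 1 with hm
  have hm0 : m ≠ 0 := by omega
  -- Idempotent lifting: (1 - X) ^ m divides q and X ^ m divides 1 - q, so q (1 - q) vanishes at b.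
  let q : Polynomial ℤ := (1 - Polynomial.X ^ m) ^ m
  have hdvd : (Polynomial.X * (1 - Polynomial.X)) ^ m ∣ (1 - q) * q := by
    rw [mul_pow]
    refine mul_dvd_mul ?_ (pow_dvd_pow_of_dvd ?_ m)
    · have := sub_dvd_pow_sub_pow (1 : Polynomial ℤ) (1 - Polynomial.X ^ m) m
      rwa [sub_sub_cancel, one_pow] at this
    · have := sub_dvd_pow_sub_pow (1 : Polynomial ℤ) Polynomial.X m
      rwa [one_pow] at this
  obtain ⟨r, hr⟩ := hdvd
  have hq : Polynomial.aeval b q = (1 - b ^ m) ^ m := by simp [q]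
  have h0 : (1 - (1 - b ^ m) ^ m) * (1 - b ^ m) ^ m = 0 := by
    have := congrArg (Polynomial.aeval b) hr
    simpa [hq, hk] using this
  have hid : (1 - b ^ m) ^ m * (1 - b ^ m) ^ m = (1 - b ^ m) ^ m := by
    rw [sub_mul, one_mul, sub_eq_zero] at h0; exact h0.symm
  rcases hI _ hid with h | h
  · left
    have hn : IsNilpotent (1 - b ^ m) := ⟨m, h⟩
    have := hn.isUnit_one_sub
    rw [sub_sub_cancel] at this
    exact (isUnit_pow_iff hm0).1 this
  · right
    have hu : IsUnit (1 - b ^ m) := (isUnit_pow_iff hm0).1 (by rw [h]; exact isUnit_one)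
    have e := (Commute.one_left b).mul_geom_sum₂ m
    rw [one_pow] at e
    rw [← e] at hu
    refine ((Commute.isUnit_mul_iff ?_).1 hu).1
    exact Commute.sum_right _ _ _ fun i _ => by
      simp only [one_pow, one_mul]
      exact (Commute.one_left _).sub_left ((Commute.refl b).pow_right _)

theorem mem_center_of_mul_mem_center {A : Type*} [Ring A] {x c : A} (hc : c ∈ Subring.center A)
    (hreg : ∀ y, c * y = 0 → y = 0) (h : x * c ∈ Subring.center A) : x ∈ Subring.center A := by
  rw [Subring.mem_center_iff]
  intro g
  rw [← sub_eq_zero]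
  apply hreg
  have h1 := mul_comm_of_mem_center h g
  rw [mul_comm_of_mem_center hc, sub_mul, mul_assoc g, ← h1, mul_assoc, mul_assoc,
    mul_comm_of_mem_center hc, sub_self]

/-- Fitting: stability makes c ^ n A meet the central annihilator of c ^ n trivially, so some b
kills that annihilator while c ^ n (1 - b) = 0. A power of b is idempotent; if it is 0 then c ^ n =
0, if it is 1 then the annihilator is zero. -/
theorem isNilpotent_or_regular_of_mem_center {A : Type*} [Ring A] (hCE : IsCentrallyEssential A)
    (hd : IsRightDistributive A) (hN : IsRightNoetherian A ∨ IsLeftNoetherian A)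
    (hI : ∀ e : A, e * e = e → e = 0 ∨ e = 1) {c : A} (hc : c ∈ Subring.center A) :
    IsNilpotent c ∨ ∀ x, c * x = 0 → x = 0 := by
  have hCN : IsCentrallyNoetherian A :=
    hN.elim IsRightNoetherian.isCentrallyNoetherian IsLeftNoetherian.isCentrallyNoetherian
  obtain ⟨n₀, hn₀⟩ := exists_ker_pow_stable hN hc
  obtain ⟨n, hn1, hn⟩ : ∃ n, 1 ≤ n ∧ ∀ m x, c ^ m * x = 0 → c ^ n * x = 0 :=
    ⟨n₀ + 1, by omega, fun m x hx => by rw [pow_succ', mul_assoc, hn₀ m x hx, mul_zero]⟩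
  have hcn : c ^ n ∈ Subring.center A := pow_mem hc n
  obtain ⟨T, hT, hS⟩ := hCN {s | s ∈ Subring.center A ∧ c ^ n * s = 0} fun s hs => hs.1
  obtain ⟨b, hb, hb'⟩ := hd.exists_separating T {c ^ n} (fun x hx => (hT hx).1)
    (by simpa using hcn) (by
      intro x hx y hy w w' hw
      rw [Finset.mem_singleton.1 hy] at hw
      rw [hw]
      apply hn (n + n)
      rw [pow_add, mul_assoc, ← hw, ← mul_assoc, (hT hx).2, zero_mul])
  have hb' : c ^ n * (1 - b) = 0 := hb' _ (Finset.mem_singleton_self _)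
  have hsb : ∀ s ∈ Subring.center A, c ^ n * s = 0 → s * b = 0 := fun s hs h =>
    mul_eq_zero_of_mem_span (T := (T : Set A)) hb (hS ⟨hs, h⟩)
  obtain ⟨k, hk⟩ := hCN.exists_ann_stable (fun k => b ^ k * (1 - b)) (by
    intro k s hs h
    rw [pow_succ', mul_assoc, ← mul_assoc, mul_comm_of_mem_center hs, mul_assoc, h, mul_zero])
  -- A nonzero central multiple d = b ^ k (1 - b) c' is killed by c ^ n, hence by b. So c' kills b ^
  -- (k + 1) (1 - b), and by stability b ^ k (1 - b), giving d = 0.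
  have hbk : b ^ k * (1 - b) = 0 := by
    by_contra h
    obtain ⟨c', hc', d, hd', -, hd0, h⟩ := hCE _ h
    apply hd0
    have hdb : d * b = 0 := hsb d hd' (by
      rw [← h, ← mul_assoc, ← mul_assoc, mul_comm_of_mem_center hcn, mul_assoc (b ^ k), hb',
        mul_zero, zero_mul])
    rw [← h, ← mul_comm_of_mem_center hc']
    apply hk (k + 1) _ hc'
    rw [pow_succ', mul_comm_of_mem_center hc', mul_assoc, mul_assoc, ← mul_assoc (b ^ k), h,
      ← mul_comm_of_mem_center hd', hdb]
  have hbb : b ^ k * b = b ^ k := by rw [mul_sub, mul_one, sub_eq_zero] at hbk; exact hbk.symm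
  have hbj : ∀ j, b ^ k * b ^ j = b ^ k := by
    intro j
    induction j with
    | zero => simp
    | succ j ih => rw [pow_succ, ← mul_assoc, ih, hbb]
  rcases hI _ (hbj k) with h | h
  · left
    have hcb : c ^ n * b = c ^ n := by
      rw [mul_sub, mul_one, sub_eq_zero] at hb'; exact hb'.symm
    have : ∀ j, c ^ n * b ^ j = c ^ n := by
      intro j
      induction j with
      | zero => simp
      | succ j ih => rw [pow_succ, ← mul_assoc, ih, hcb]
    exact ⟨n, by rw [← this k, h, mul_zero]⟩
  · right
    rw [h, one_mul] at hbb
    intro x hx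
    by_contra hx0
    obtain ⟨c', hc', d, hd', -, hd0, h⟩ := hCE _ hx0
    apply hd0
    have := hsb d hd' (by
      rw [← h, ← mul_assoc, ← Nat.sub_add_cancel hn1, pow_succ, mul_assoc _ c, hx, mul_zero,
        zero_mul])
    rwa [hbb, mul_one] at this

/-! ### The central socle; elements are nilpotent or invertible -/

/-- The central elements annihilated by all central nilpotent elements. -/
def centralSocle (A : Type*) [Ring A] : Set A :=
  {d | d ∈ Subring.center A ∧ ∀ t ∈ Subring.center A, IsNilpotent t → d * t = 0}

section Socle

variable {A : Type*} [Ring A] {d : A}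

/-- If b d c is central and nonzero with c central, then c is not nilpotent, because d kills central
nilpotents. So c is regular and cancels: `centralSocle A` is stable under multiplication yet
consists of central elements. -/
theorem mul_mem_centralSocle (hCE : IsCentrallyEssential A)
    (hreg : ∀ c ∈ Subring.center A, IsNilpotent c ∨ ∀ x, c * x = 0 → x = 0)
    (h : d ∈ centralSocle A) (b : A) : b * d ∈ centralSocle A := by
  refine ⟨?_, fun t ht hn => by rw [mul_assoc, h.2 t ht hn, mul_zero]⟩
  by_cases h0 : b * d = 0
  · rw [h0]; exact zero_mem _
  obtain ⟨c, hc, e, he, -, he0, hce⟩ := hCE _ h0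
  refine mem_center_of_mul_mem_center hc ?_ (hce ▸ he)
  refine (hreg c hc).resolve_left fun hn => he0 ?_
  rw [← hce, mul_assoc, h.2 c hc hn, mul_zero]

theorem mul_left_comm_of_mem_centralSocle (hCE : IsCentrallyEssential A)
    (hreg : ∀ c ∈ Subring.center A, IsNilpotent c ∨ ∀ x, c * x = 0 → x = 0)
    (h : d ∈ centralSocle A) (a b : A) : a * (b * d) = b * (a * d) := by
  rw [← mul_comm_of_mem_center (mul_mem_centralSocle hCE hreg h b).1, mul_assoc,
    mul_comm_of_mem_center h.1]

/-- Finitely many central nilpotents suffice. For each in turn, multiply by its last power that does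
not kill the element. -/
theorem exists_mul_mem_centralSocle (hCN : IsCentrallyNoetherian A) (hd : d ∈ Subring.center A)
    (hd0 : d ≠ 0) : ∃ s ∈ Subring.center A, d * s ≠ 0 ∧ d * s ∈ centralSocle A := by
  classical
  obtain ⟨T, hT, hS⟩ := hCN {t | t ∈ Subring.center A ∧ IsNilpotent t} fun s hs => hs.1
  have key : ∀ T : Finset A, (∀ t ∈ T, t ∈ Subring.center A ∧ IsNilpotent t) →
      ∃ s ∈ Subring.center A, d * s ≠ 0 ∧ ∀ t ∈ T, t * (d * s) = 0 := by
    intro T hT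
    induction T using Finset.induction_on with
    | empty => exact ⟨1, one_mem _, by simpa using hd0, by simp⟩
    | insert t T ht ih =>
      obtain ⟨s, hs, hds, hs'⟩ := ih fun t ht => hT t (Finset.mem_insert_of_mem ht)
      obtain ⟨htc, htn⟩ := hT t (Finset.mem_insert_self _ _)
      have hex : ∃ j, d * s * t ^ j = 0 := htn.imp fun j hj => by rw [hj, mul_zero]
      have hj0 : Nat.find hex ≠ 0 := fun h => hds (by
        have := Nat.find_spec hex
        rwa [h, pow_zero, mul_one] at this)
      obtain ⟨j, hj⟩ := Nat.exists_eq_succ_of_ne_zero hj0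
      have hj1 := Nat.find_spec hex
      have hj2 := Nat.find_min hex (m := j) (by omega)
      rw [hj] at hj1
      refine ⟨s * t ^ j, mul_mem hs (pow_mem htc j), by rwa [← mul_assoc], fun x hx => ?_⟩
      rcases Finset.mem_insert.1 hx with rfl | hx
      · rw [mul_comm_of_mem_center htc, ← mul_assoc, mul_assoc, ← pow_succ, hj1]
      · rw [← mul_assoc, ← mul_assoc, mul_assoc x, hs' x hx, zero_mul]
  obtain ⟨s, hs, hds, h⟩ := key T fun t ht => hT ht
  have hdsc := mul_mem hd hs
  refine ⟨s, hs, hds, hdsc, fun t ht hn => ?_⟩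
  rw [mul_comm_of_mem_center hdsc]
  exact mul_eq_zero_of_mem_span (T := (T : Set A)) h (hS ⟨ht, hn⟩)

theorem eq_zero_of_forall_centralSocle (hCE : IsCentrallyEssential A)
    (hCN : IsCentrallyNoetherian A) {x : A}
    (h : ∀ c ∈ Subring.center A, x * c ∈ centralSocle A → x * c = 0) : x = 0 := by
  by_contra hx
  obtain ⟨c, hc, d, hd, -, hd0, hxc⟩ := hCE _ hx
  obtain ⟨s, hs, hds, hds'⟩ := exists_mul_mem_centralSocle hCN hd hd0
  rw [← hxc, mul_assoc] at hds hds'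
  exact hds (h _ (mul_mem hc hs) hds')

theorem isNilpotent_of_forall_centralSocle (hCE : IsCentrallyEssential A)
    (hCN : IsCentrallyNoetherian A) {a : A} (h : ∀ d ∈ centralSocle A, a * d = 0) :
    IsNilpotent a := by
  obtain ⟨n, hn⟩ := hCN.exists_ann_stable (fun n => a ^ n) (by
    intro n s hs h
    rw [pow_succ, ← mul_assoc, h, zero_mul])
  refine ⟨n, eq_zero_of_forall_centralSocle hCE hCN fun c hc hac => ?_⟩
  rw [← mul_comm_of_mem_center hc]
  apply hn (n + 1) c hc
  have := h _ hac
  rwa [← mul_assoc, ← pow_succ', ← mul_comm_of_mem_center hc] at this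

/-- Since d kills z ≠ 0, d is nilpotent and d d = 0. With d a = b x and b (1 - a) = d y one gets b d
(1 - a) = d d y = 0, so d = d a = b x. As in `mul_mem_centralSocle`, cancelling a regular central
element shows x central. -/
theorem exists_eq_mul_of_mem_centralSocle (hCE : IsCentrallyEssential A)
    (hdist : IsRightDistributive A)
    (hreg : ∀ c ∈ Subring.center A, IsNilpotent c ∨ ∀ x, c * x = 0 → x = 0)
    {z : A} (hz : z ∈ Subring.center A) (hz0 : z ≠ 0) (hzn : IsNilpotent z)
    (h : d ∈ centralSocle A) {b : A} (hb : ∀ x, b * x = 0 → x = 0) :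
    ∃ w ∈ centralSocle A, d = b * w := by
  have hdd : d * d = 0 := by
    rcases hreg d h.1 with hn | hr
    · exact h.2 d h.1 hn
    · exact absurd (hr z (h.2 z hz hzn)) hz0
  obtain ⟨a, x, y, h1, h2⟩ := isRightDistributive_iff.1 hdist d b
  have h3 : d * (1 - a) = 0 := by
    apply hb
    rw [← mul_assoc, ← mul_comm_of_mem_center h.1, mul_assoc, h2, ← mul_assoc, hdd, zero_mul]
  have h4 : d = b * x := by
    rw [← h1, ← sub_eq_zero]; rw [mul_sub, mul_one] at h3; exact h3
  refine ⟨x, ⟨?_, fun t ht hn => hb _ (by rw [← mul_assoc, ← h4, h.2 t ht hn])⟩, h4⟩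
  by_cases h0 : x = 0
  · rw [h0]; exact zero_mem _
  obtain ⟨c, hc, e, he, -, he0, hce⟩ := hCE _ h0
  refine mem_center_of_mul_mem_center hc ?_ (hce ▸ he)
  refine (hreg c hc).resolve_left fun hn => he0 (hb _ ?_)
  rw [← hce, ← mul_assoc, ← h4, h.2 c hc hn]

/-- The Fitting argument again, for a ^ n acting on `centralSocle A`, where all products are
central. Here b (1 - b) is only shown nilpotent, which suffices by idempotent lifting. -/
theorem isNilpotent_or_regular (hCE : IsCentrallyEssential A) (hdist : IsRightDistributive A)
    (hCN : IsCentrallyNoetherian A)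
    (hreg : ∀ c ∈ Subring.center A, IsNilpotent c ∨ ∀ x, c * x = 0 → x = 0)
    (hI : ∀ e : A, e * e = e → e = 0 ∨ e = 1) (a : A) :
    IsNilpotent a ∨ ∀ x, a * x = 0 → x = 0 := by
  obtain ⟨n₀, hn₀⟩ := hCN.exists_ann_stable (fun n => a ^ n) (by
    intro n s hs h
    rw [pow_succ, ← mul_assoc, h, zero_mul])
  obtain ⟨n, hn1, hn⟩ : ∃ n, 1 ≤ n ∧ ∀ m, ∀ s ∈ Subring.center A, a ^ m * s = 0 →
      a ^ n * s = 0 := ⟨n₀ + 1, by omega, fun m s hs h => by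
        rw [pow_succ', mul_assoc, ← mul_comm_of_mem_center hs,
          hn₀ m s hs (by rw [mul_comm_of_mem_center hs, h]), mul_zero]⟩
  have hmul := fun {d : A} (h : d ∈ centralSocle A) => mul_mem_centralSocle hCE hreg h
  have hcomm := fun {d : A} (h : d ∈ centralSocle A) =>
    mul_left_comm_of_mem_centralSocle hCE hreg h
  obtain ⟨X, hX, hX'⟩ := hCN {d | d ∈ centralSocle A ∧ a ^ n * d = 0} fun s hs => hs.1.1
  obtain ⟨Y, hY, hY'⟩ := hCN {y | ∃ d ∈ centralSocle A, a ^ n * d = y} (by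
    rintro _ ⟨d, hd, rfl⟩; exact (hmul hd _).1)
  obtain ⟨b, hb, hb'⟩ := hdist.exists_separating X Y (fun x hx => (hX hx).1.1)
    (fun y hy => by obtain ⟨d, hd, rfl⟩ := hY hy; exact (hmul hd _).1) (by
      intro x hx y hy w w' hw
      obtain ⟨d, hd, rfl⟩ := hY hy
      have e : a ^ n * d * w' = a ^ n * (w' * d) := by
        rw [mul_assoc, mul_comm_of_mem_center hd.1]
      rw [hw, e]
      apply hn (n + n) _ (hmul hd _).1
      rw [pow_add, mul_assoc, ← e, ← hw, ← mul_assoc, (hX hx).2, zero_mul])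
  have hb1 : ∀ d ∈ centralSocle A, a ^ n * d = 0 → d * b = 0 := fun d hd h =>
    mul_eq_zero_of_mem_span (T := (X : Set A)) hb (hX' ⟨hd, h⟩)
  have hb2 : ∀ d ∈ centralSocle A, a ^ n * d * (1 - b) = 0 := fun d hd =>
    mul_eq_zero_of_mem_span (T := (Y : Set A)) hb' (hY' ⟨d, hd, rfl⟩)
  have hnil : IsNilpotent (b * (1 - b)) := by
    refine isNilpotent_of_forall_centralSocle hCE hCN fun d hd => ?_
    have h1 := hmul hd (1 - b)
    rw [mul_assoc, ← mul_comm_of_mem_center h1.1]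
    apply hb1 _ h1
    rw [hcomm hd, ← mul_comm_of_mem_center (hmul hd _).1, hb2 d hd]
  rcases isUnit_or_isUnit_one_sub_of_isNilpotent hI hnil with hu | hu
  · right
    intro x hx
    refine eq_zero_of_forall_centralSocle hCE hCN fun c hc hxc => ?_
    refine (hu.mul_left_eq_zero).1 (hb1 _ hxc ?_)
    rw [← Nat.sub_add_cancel hn1, pow_succ, mul_assoc, ← mul_assoc a, hx, zero_mul, mul_zero]
  · left
    have : IsNilpotent (a ^ n) := isNilpotent_of_forall_centralSocle hCE hCN fun d hd =>
      (hu.mul_left_eq_zero).1 (hb2 d hd)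
    obtain ⟨j, hj⟩ := this
    exact ⟨n * j, by rw [pow_mul, hj]⟩

/-- A regular a divides socle elements inside the socle, giving nonzero w n = a w (n + 1) with
ascending ideals. When these stop, w (N + 1) = t w N = t a w (N + 1), so 1 - t a is not regular,
hence nilpotent, and t a is a unit. The left inverse a' of a is two-sided because a a' is a nonzero
idempotent. -/
theorem isNilpotent_or_isUnit [Nontrivial A] (hCE : IsCentrallyEssential A)
    (hdist : IsRightDistributive A) (hCN : IsCentrallyNoetherian A)
    (hreg : ∀ c ∈ Subring.center A, IsNilpotent c ∨ ∀ x, c * x = 0 → x = 0)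
    (hI : ∀ e : A, e * e = e → e = 0 ∨ e = 1)
    {z : A} (hz : z ∈ Subring.center A) (hz0 : z ≠ 0) (hzn : IsNilpotent z) (a : A) :
    IsNilpotent a ∨ IsUnit a := by
  refine (isNilpotent_or_regular hCE hdist hCN hreg hI a).imp_right fun ha => ?_
  obtain ⟨s, hs, hd0, hd⟩ := exists_mul_mem_centralSocle hCN hz hz0
  choose! f hf hf' using fun d (hd : d ∈ centralSocle A) =>
    exists_eq_mul_of_mem_centralSocle hCE hdist hreg hz hz0 hzn hd ha
  let w : ℕ → A := fun n => f^[n] (z * s)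
  have hw : ∀ n, w n ∈ centralSocle A := fun n => by
    induction n with
    | zero => exact hd
    | succ n ih => simp only [w, Function.iterate_succ_apply']; exact hf _ ih
  have hw1 : ∀ n, w n = a * w (n + 1) := fun n => by
    simp only [w, Function.iterate_succ_apply']; exact hf' _ (hw n)
  have hw0 : ∀ n, w n ≠ 0 := fun n => by
    induction n with
    | zero => exact hd0
    | succ n ih => intro h; exact ih (by rw [hw1, h, mul_zero])
  have hmono : ∀ n m, n ≤ m → w n ∈ Ideal.span {w m} := by
    intro n m hnm
    induction m, hnm using Nat.le_induction with
    | base => exact Ideal.mem_span_singleton_self _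
    | succ m _ ih =>
      refine Ideal.span_le.2 ?_ ih
      rw [Set.singleton_subset_iff, hw1 m]
      exact Ideal.mul_mem_left _ _ (Ideal.mem_span_singleton_self _)
  obtain ⟨T, hT, hS⟩ := hCN (Set.range w) (by rintro _ ⟨n, rfl⟩; exact (hw n).1)
  have hT' : ∀ t, ∃ n, t ∈ T → w n = t := fun t => by
    by_cases ht : t ∈ T
    · obtain ⟨n, hn⟩ := hT ht
      exact ⟨n, fun _ => hn⟩
    · exact ⟨0, fun h => absurd h ht⟩
  choose n hn using hT'
  set N := T.sup n
  have hle : Ideal.span (T : Set A) ≤ Ideal.span {w N} := by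
    refine Ideal.span_le.2 fun t ht => ?_
    rw [← hn t ht]
    exact hmono _ _ (Finset.le_sup (f := n) ht)
  obtain ⟨t, ht⟩ := Submodule.mem_span_singleton.1 (hle (hS ⟨N + 1, rfl⟩))
  have hta : (1 - t * a) * w (N + 1) = 0 := by
    rw [sub_mul, one_mul, mul_assoc, ← hw1, sub_eq_zero]
    exact ht.symm
  have hunit : IsUnit (t * a) := by
    rcases isNilpotent_or_regular hCE hdist hCN hreg hI (1 - t * a) with h | h
    · have := h.isUnit_one_sub
      rwa [sub_sub_cancel] at this
    · exact absurd (h _ hta) (hw0 _)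
  obtain ⟨v, hv⟩ := hunit
  have hl : (↑v⁻¹ * t) * a = 1 := by rw [mul_assoc, ← hv, Units.inv_mul]
  set a' := ↑v⁻¹ * t
  have hid : a * a' * (a * a') = a * a' := by
    rw [mul_assoc, ← mul_assoc a', hl, one_mul]
  rcases hI _ hid with h | h
  · have : a = 0 := by rw [← mul_one a, ← hl, ← mul_assoc, h, zero_mul]
    rw [this, mul_zero] at hl
    exact absurd hl zero_ne_one
  · exact ⟨⟨a, a', h, hl⟩, rfl⟩

theorem isCommutativeRing_of_forall_regular (hCE : IsCentrallyEssential A)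
    (hreg : ∀ c ∈ Subring.center A, c ≠ 0 → ∀ x, c * x = 0 → x = 0) :
    IsCommutativeRing A := by
  intro a b
  by_cases ha : a = 0
  · simp [ha]
  obtain ⟨c, hc, d, hd, hc0, -, hcd⟩ := hCE a ha
  exact mul_comm_of_mem_center (mem_center_of_mul_mem_center hc (hreg c hc hc0) (hcd ▸ hd)) b

end Socle

/-! ### Rings whose elements are nilpotent or invertible -/

section Local

variable {A : Type*} [Ring A]

theorem isUnit_of_isUnit_mul_right [Nontrivial A] (hA : ∀ a : A, IsNilpotent a ∨ IsUnit a)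
    {a b : A} (h : IsUnit (a * b)) : IsUnit a := by
  refine (hA a).resolve_left fun ⟨k, hk⟩ => ?_
  obtain ⟨v, hv⟩ := h
  have h1 : a * (b * ↑v⁻¹) = 1 := by rw [← mul_assoc, ← hv, Units.mul_inv]
  have h2 : ∀ k, a ^ k * (b * ↑v⁻¹) ^ k = 1 := by
    intro k
    induction k with
    | zero => simp
    | succ k ih => rw [pow_succ, pow_succ', mul_assoc, ← mul_assoc a, h1, one_mul, ih]
  have := h2 k
  rw [hk, zero_mul] at this
  exact zero_ne_one this

theorem isUnit_of_isUnit_mul_left [Nontrivial A] (hA : ∀ a : A, IsNilpotent a ∨ IsUnit a)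
    {a b : A} (h : IsUnit (a * b)) : IsUnit b := by
  refine (hA b).resolve_left fun ⟨k, hk⟩ => ?_
  obtain ⟨v, hv⟩ := h
  have h1 : ↑v⁻¹ * a * b = 1 := by rw [mul_assoc, ← hv, Units.inv_mul]
  have h2 : ∀ k, (↑v⁻¹ * a) ^ k * b ^ k = 1 := by
    intro k
    induction k with
    | zero => simp
    | succ k ih => rw [pow_succ, pow_succ', mul_assoc, ← mul_assoc _ b, h1, one_mul, ih]
  have := h2 k
  rw [hk, mul_zero] at this
  exact zero_ne_one this

theorem isUnit_or_isUnit_of_isUnit_add [Nontrivial A] (hA : ∀ a : A, IsNilpotent a ∨ IsUnit a)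
    {a b : A} (h : IsUnit (a + b)) : IsUnit a ∨ IsUnit b := by
  obtain ⟨v, hv⟩ := h
  have h1 : 1 - a * ↑v⁻¹ = b * ↑v⁻¹ := by
    rw [sub_eq_iff_eq_add', ← add_mul, ← hv, Units.mul_inv]
  rcases hA (a * ↑v⁻¹) with h | h
  · right
    have := h.isUnit_one_sub
    rw [h1] at this
    exact isUnit_of_isUnit_mul_right hA this
  · exact Or.inl (isUnit_of_isUnit_mul_right hA h)

/-- The ideal of all non-invertible elements. -/
def nonunitsIdeal [Nontrivial A] (hA : ∀ a : A, IsNilpotent a ∨ IsUnit a) : Ideal A where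
  carrier := {a | ¬ IsUnit a}
  add_mem' ha hb h := (isUnit_or_isUnit_of_isUnit_add hA h).elim ha hb
  zero_mem' := not_isUnit_zero
  smul_mem' _ _ hx h := hx (isUnit_of_isUnit_mul_left hA h)

theorem nonunitsIdeal_isTwoSided [Nontrivial A] (hA : ∀ a : A, IsNilpotent a ∨ IsUnit a) :
    (nonunitsIdeal hA).IsTwoSided :=
  ⟨fun _ ha h => ha (isUnit_of_isUnit_mul_right hA h)⟩

/-- One of a, 1 - a is a unit. Divisibility n ∣ m means m ∈ nA, so right ideals form a chain. -/
theorem IsRightDistributive.dvd_or_dvd (hA : ∀ a : A, IsNilpotent a ∨ IsUnit a)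
    (hd : IsRightDistributive A) (m n : A) : n ∣ m ∨ m ∣ n := by
  obtain ⟨a, x, y, h1, h2⟩ := isRightDistributive_iff.1 hd m n
  rcases hA a with h | h
  · right
    obtain ⟨v, hv⟩ := h.isUnit_one_sub
    exact ⟨y * ↑v⁻¹, by rw [← mul_assoc, ← h2, ← hv, mul_assoc, Units.mul_inv, mul_one]⟩
  · left
    obtain ⟨v, hv⟩ := h
    exact ⟨x * ↑v⁻¹, by rw [← mul_assoc, ← h1, ← hv, mul_assoc, Units.mul_inv, mul_one]⟩

/-- Right ideals are two-sided. For a unit u, if p = u p v then v invertible gives u p = p v⁻¹, and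
v nilpotent gives p = u ^ n p v ^ n = 0. For nilpotent x use the unit 1 - x. -/
theorem IsRightDistributive.dvd_mul_self (hA : ∀ a : A, IsNilpotent a ∨ IsUnit a)
    (hd : IsRightDistributive A) (p x : A) : p ∣ x * p := by
  have key : ∀ u, IsUnit u → p ∣ u * p := by
    rintro _ ⟨u, rfl⟩
    rcases hd.dvd_or_dvd hA (u * p) p with h | ⟨v, hv⟩
    · exact h
    rcases hA v with ⟨n, hn⟩ | ⟨v, rfl⟩
    · have h1 : ∀ n, p = (u : A) ^ n * p * v ^ n := by
        intro n
        induction n with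
        | zero => simp
        | succ n ih =>
          conv_lhs => rw [ih, hv]
          rw [pow_succ, pow_succ']
          simp only [mul_assoc]
      have h2 := h1 n
      rw [hn, mul_zero] at h2
      rw [h2, mul_zero]
    · exact ⟨↑v⁻¹, by conv_rhs => rw [hv, mul_assoc, Units.mul_inv, mul_one]⟩
  rcases hA x with h | h
  · have := dvd_sub (dvd_refl p) (key _ h.isUnit_one_sub)
    rwa [sub_mul, one_mul, sub_sub_cancel] at this
  · exact key _ h

theorem IsRightDistributive.exists_dvd_finset [Nontrivial A]
    (hA : ∀ a : A, IsNilpotent a ∨ IsUnit a) (hd : IsRightDistributive A) (T : Finset A)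
    (hT : ∀ t ∈ T, ¬ IsUnit t) : ∃ p, ¬ IsUnit p ∧ ∀ t ∈ T, p ∣ t := by
  classical
  induction T using Finset.induction_on with
  | empty => exact ⟨0, not_isUnit_zero, by simp⟩
  | insert t T ht ih =>
    obtain ⟨p, hp, h⟩ := ih fun t ht => hT t (Finset.mem_insert_of_mem ht)
    rcases hd.dvd_or_dvd hA t p with h' | h'
    · refine ⟨p, hp, fun x hx => ?_⟩
      rcases Finset.mem_insert.1 hx with rfl | hx
      · exact h'
      · exact h x hx
    · refine ⟨t, hT t (Finset.mem_insert_self _ _), fun x hx => ?_⟩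
      rcases Finset.mem_insert.1 hx with rfl | hx
      · exact dvd_refl _
      · exact h'.trans (h x hx)

theorem IsRightDistributive.exists_dvd_of_not_isUnit [Nontrivial A]
    (hA : ∀ a : A, IsNilpotent a ∨ IsUnit a) (hd : IsRightDistributive A)
    (hN : IsRightNoetherian A ∨ IsLeftNoetherian A) :
    ∃ p : A, ¬ IsUnit p ∧ ∀ x, ¬ IsUnit x → p ∣ x := by
  rcases hN with h | h
  · have h' : IsNoetherian Aᵐᵒᵖ A := h
    let J : Submodule Aᵐᵒᵖ A :=
      { nonunitsIdeal hA with
        smul_mem' := fun a x hx h => hx (isUnit_of_isUnit_mul_right hA h) }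
    obtain ⟨T, hT⟩ := IsNoetherian.noetherian J
    have hTJ : ∀ t ∈ T, ¬ IsUnit t := fun t ht =>
      show t ∈ J from hT ▸ Submodule.subset_span ht
    obtain ⟨p, hp, h⟩ := hd.exists_dvd_finset hA T hTJ
    refine ⟨p, hp, fun x hx => ?_⟩
    have hx : x ∈ Submodule.span Aᵐᵒᵖ (T : Set A) := hT ▸ (show x ∈ J from hx)
    exact Submodule.span_induction (p := fun x _ => p ∣ x) h (dvd_zero p)
      (fun _ _ _ _ => dvd_add) (fun a x _ hx => hx.mul_right (unop a)) hx
  · have h' : IsNoetherian A A := h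
    obtain ⟨T, hT⟩ := IsNoetherian.noetherian (nonunitsIdeal hA)
    have hTJ : ∀ t ∈ T, ¬ IsUnit t := fun t ht =>
      show t ∈ nonunitsIdeal hA from hT ▸ Submodule.subset_span ht
    obtain ⟨p, hp, h⟩ := hd.exists_dvd_finset hA T hTJ
    refine ⟨p, hp, fun x hx => ?_⟩
    have hx : x ∈ Submodule.span A (T : Set A) := hT ▸ (show x ∈ nonunitsIdeal hA from hx)
    refine Submodule.span_induction (p := fun x _ => p ∣ x) h (dvd_zero p)
      (fun _ _ _ _ => dvd_add) (fun a x _ hx => ?_) hx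
    obtain ⟨y, rfl⟩ := hx
    rw [smul_eq_mul, ← mul_assoc]
    exact (hd.dvd_mul_self hA p a).mul_right y

end Local

/-! ### Chain rings with a nilpotent generator of the radical -/

theorem exists_eq_pow_mul_of_dvd {A : Type*} [Ring A] {p : A} (hp : IsNilpotent p)
    (hdvd : ∀ x, ¬ IsUnit x → p ∣ x) (x : A) : ∃ k u, IsUnit u ∧ x = p ^ k * u := by
  obtain ⟨n, hn⟩ := hp
  have key : ∀ k, (∃ k u, IsUnit u ∧ x = p ^ k * u) ∨ ∃ y, x = p ^ k * y := by
    intro k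
    induction k with
    | zero => exact Or.inr ⟨x, by simp⟩
    | succ k ih =>
      rcases ih with h | ⟨y, hy⟩
      · exact Or.inl h
      · by_cases hu : IsUnit y
        · exact Or.inl ⟨k, y, hu, hy⟩
        · obtain ⟨w, rfl⟩ := hdvd y hu
          exact Or.inr ⟨w, by rw [hy, pow_succ, mul_assoc]⟩
  rcases key n with h | ⟨y, hy⟩
  · exact h
  · exact ⟨n, 1, isUnit_one, by rw [hy, hn]; simp⟩

/-- Each element generates the same submodule as some f k. A submodule is determined by which f k
with k < n it contains, so there are finitely many. -/
theorem isUniserialModule_and_isArtinian_of_chain {R M : Type*} [Ring R] [AddCommGroup M]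
    [Module R M] (f : ℕ → M) (n : ℕ) (hn : ∀ k, n ≤ k → f k = 0)
    (hf : ∀ i j, i ≤ j → ∃ r : R, f j = r • f i)
    (h : ∀ x, ∃ k, ∃ r s : R, x = r • f k ∧ f k = s • x) :
    IsUniserialModule R M ∧ IsArtinian R M := by
  constructor
  · rw [isUniserialModule_iff]
    have key : ∀ x y : M, ∀ i j, i ≤ j → (∃ r : R, f i = r • x) → (∃ r : R, y = r • f j) →
        ∃ r : R, y = r • x := by
      rintro x y i j hij ⟨r, hr⟩ ⟨s, rfl⟩
      obtain ⟨t, ht⟩ := hf i j hij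
      exact ⟨s * t * r, by rw [ht, hr, smul_smul, smul_smul, mul_assoc]⟩
    intro x y
    obtain ⟨i, r, s, h1, h2⟩ := h x
    obtain ⟨j, r', s', h1', h2'⟩ := h y
    rcases le_total i j with hij | hij
    · exact Or.inr (key x y i j hij ⟨s, h2⟩ ⟨r', h1'⟩)
    · exact Or.inl (key y x j i hij ⟨s', h2'⟩ ⟨r, h1⟩)
  · have : Function.Injective fun (X : Submodule R M) => {k : Fin n | f k ∈ X} := by
      have key : ∀ X Y : Submodule R M, {k : Fin n | f k ∈ X} = {k : Fin n | f k ∈ Y} → X ≤ Y := by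
        intro X Y hXY x hx
        obtain ⟨k, r, s, h1, h2⟩ := h x
        rw [h1]
        refine Y.smul_mem _ ?_
        by_cases hk : n ≤ k
        · rw [hn k hk]; exact Y.zero_mem
        · have : (⟨k, by omega⟩ : Fin n) ∈ {k : Fin n | f k ∈ X} := by
            change f k ∈ X
            rw [h2]
            exact X.smul_mem _ hx
          rw [hXY] at this
          exact this
      exact fun X Y hXY => le_antisymm (key X Y hXY) (key Y X hXY.symm)
    have := Finite.of_injective _ this
    exact Finite.to_wellFoundedLT

theorem isUniserialArtinian_of_generator {A : Type*} [Ring A] {p : A} (hp : IsNilpotent p)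
    (hr : ∀ x, ¬ IsUnit x → ∃ y, x = p * y) (hl : ∀ x, ¬ IsUnit x → ∃ y, x = y * p) :
    IsUniserialArtinian A := by
  obtain ⟨n, hn⟩ := id hp
  have h0 : ∀ k, n ≤ k → p ^ k = 0 := fun k hk => pow_eq_zero_of_le hk hn
  have h1 : IsUniserialModule Aᵐᵒᵖ A ∧ IsArtinian Aᵐᵒᵖ A := by
    refine isUniserialModule_and_isArtinian_of_chain (fun k => p ^ k) n h0 (fun i j hij => ?_)
      fun x => ?_
    · exact ⟨op (p ^ (j - i)), by
        change p ^ j = p ^ i * p ^ (j - i)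
        rw [← pow_add, Nat.add_sub_cancel' hij]⟩
    · obtain ⟨k, _, ⟨u, rfl⟩, hk⟩ := exists_eq_pow_mul_of_dvd hp hr x
      refine ⟨k, op (u : A), op (↑u⁻¹ : A), hk, ?_⟩
      change p ^ k = x * ↑u⁻¹
      rw [hk, mul_assoc, Units.mul_inv, mul_one]
  have h2 : IsUniserialModule A A ∧ IsArtinian A A := by
    refine isUniserialModule_and_isArtinian_of_chain (fun k => p ^ k) n h0 (fun i j hij => ?_)
      fun x => ?_
    · exact ⟨p ^ (j - i), by rw [smul_eq_mul, ← pow_add, Nat.sub_add_cancel hij]⟩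
    · have hp' : IsNilpotent (op p) := ⟨n, by rw [← op_pow, hn, op_zero]⟩
      obtain ⟨k, u, hu, hk⟩ := exists_eq_pow_mul_of_dvd hp' (fun x hx => by
        obtain ⟨y, hy⟩ := hl (unop x) (by rwa [isUnit_unop])
        exact ⟨op y, by rw [← op_mul, ← hy, op_unop]⟩) (op x)
      obtain ⟨v, hv⟩ := isUnit_unop.2 hu
      have hk : x = v * p ^ k := by
        rw [hv, ← unop_op (p ^ k), ← unop_mul, op_pow, ← hk, unop_op]
      exact ⟨k, v, ↑v⁻¹, hk, by rw [smul_eq_mul, hk, ← mul_assoc, Units.inv_mul, one_mul]⟩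
  exact ⟨⟨h1.1, h2.1⟩, h1.2, h2.2⟩

theorem exists_mul_pow_eq {A : Type*} [Ring A] {p : A} (hp : ∀ x, p ∣ x * p) (k : ℕ) (b : A) :
    p ^ k ∣ b * p ^ k := by
  induction k with
  | zero => simp
  | succ k ih =>
    obtain ⟨y, hy⟩ := ih
    obtain ⟨z, hz⟩ := hp y
    exact ⟨z, by rw [pow_succ, ← mul_assoc, hy, mul_assoc, hz, mul_assoc]⟩

section Generator

variable {A : Type*} [Ring A] {p : A}

theorem not_isUnit_of_pow_mul_eq_zero {k : ℕ} {x : A} (hk : p ^ k ≠ 0) (h : p ^ k * x = 0) :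
    ¬ IsUnit x := fun hu => hk ((hu.mul_left_eq_zero).1 h)

/-- Commuting z = p ^ (k + 1) u with u⁻¹ y u yields p ^ (k + 1) (y - w) = 0 for some w with p w ∈
Ap. So y - w ∈ pA and p y ∈ Ap + p ^ 2 A; iterating, nilpotency of p removes the error term. -/
theorem exists_eq_mul_generator [Nontrivial A] (hA : ∀ a : A, IsNilpotent a ∨ IsUnit a)
    (hp : ¬ IsUnit p)
    (hr : ∀ x, ¬ IsUnit x → p ∣ x) (hpp : ∀ x, p ∣ x * p) {z : A} (hz : z ∈ Subring.center A)
    (hz0 : z ≠ 0) (hzu : ¬ IsUnit z) (y : A) : ∃ v, p * y = v * p := by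
  have hpn := (hA p).resolve_right hp
  obtain ⟨k, _, ⟨u, rfl⟩, hk⟩ := exists_eq_pow_mul_of_dvd hpn hr z
  obtain ⟨k, rfl⟩ : ∃ j, k = j + 1 := Nat.exists_eq_succ_of_ne_zero (by
    rintro rfl
    exact hzu (by rw [hk]; simp))
  have hpk : p ^ (k + 1) ≠ 0 := fun h => hz0 (by rw [hk, h, zero_mul])
  have step : ∀ y, ∃ v w, p * y = v * p + p * p * w := by
    intro y
    obtain ⟨v, hv⟩ := exists_mul_pow_eq hpp k (↑u⁻¹ * y * u)
    obtain ⟨w, hw⟩ := hpp v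
    have h1 : p ^ (k + 1) * (y - w) = 0 := by
      have e1 : z * (↑u⁻¹ * y * u) = p ^ (k + 1) * y * u := by
        rw [hk, mul_assoc (p ^ (k + 1)), ← mul_assoc (u : A), ← mul_assoc (u : A), Units.mul_inv,
          one_mul, mul_assoc]
      have e2 : ↑u⁻¹ * y * u * z = p ^ (k + 1) * w * u := by
        rw [hk, ← mul_assoc, pow_succ, ← mul_assoc _ (p ^ k), hv, mul_assoc _ v, hw, ← mul_assoc]
      have := mul_comm_of_mem_center hz (↑u⁻¹ * y * u)
      rw [e1, e2, Units.mul_left_inj] at this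
      rw [mul_sub, this, sub_self]
    obtain ⟨t, ht⟩ := hr _ (not_isUnit_of_pow_mul_eq_zero hpk h1)
    exact ⟨v, t, by rw [hw, mul_assoc, ← ht, mul_sub]; abel⟩
  have key : ∀ j, ∃ v w, p * y = v * p + p ^ (j + 1) * w := by
    intro j
    induction j with
    | zero => exact ⟨0, y, by simp⟩
    | succ j ih =>
      obtain ⟨v, w, hvw⟩ := ih
      obtain ⟨v', w', h'⟩ := step w
      refine ⟨v + p ^ j * v', w', ?_⟩
      rw [hvw, pow_succ, mul_assoc, h', pow_succ, pow_succ]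
      noncomm_ring
  obtain ⟨n, hn⟩ := hpn
  obtain ⟨v, w, h⟩ := key n
  exact ⟨v, by rw [h, pow_succ, hn]; simp⟩

end Generator

/-! ### The structure of indecomposable rings -/

theorem indecomposable_structure {A : Type*} [Ring A] [Nontrivial A]
    (hCE : IsCentrallyEssential A) (hd : IsRightDistributive A)
    (hN : IsRightNoetherian A ∨ IsLeftNoetherian A)
    (hI : ∀ e : A, e * e = e → e = 0 ∨ e = 1) :
    IsCommutativeDedekindDomain A ∨ ∃ p : A, (∀ a : A, IsNilpotent a ∨ IsUnit a) ∧ ¬ IsUnit p ∧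
      (∀ x, ¬ IsUnit x → p ∣ x) ∧ (∀ x, ¬ IsUnit x → ∃ y, x = y * p) ∧ ∀ x, p ∣ x * p := by
  have hCN : IsCentrallyNoetherian A :=
    hN.elim IsRightNoetherian.isCentrallyNoetherian IsLeftNoetherian.isCentrallyNoetherian
  have hreg : ∀ c ∈ Subring.center A, IsNilpotent c ∨ ∀ x, c * x = 0 → x = 0 := fun c hc =>
    isNilpotent_or_regular_of_mem_center hCE hd hN hI hc
  by_cases hz : ∃ z ∈ Subring.center A, z ≠ 0 ∧ IsNilpotent z
  · right
    obtain ⟨z, hz, hz0, hzn⟩ := hz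
    have hA := isNilpotent_or_isUnit hCE hd hCN hreg hI hz hz0 hzn
    obtain ⟨p, hp, hr⟩ := hd.exists_dvd_of_not_isUnit hA hN
    have hpp := hd.dvd_mul_self hA p
    refine ⟨p, hA, hp, hr, fun x hx => ?_, hpp⟩
    obtain ⟨y, rfl⟩ := hr x hx
    refine exists_eq_mul_generator hA hp hr hpp hz hz0 (fun hu => ?_) y
    obtain ⟨n, hn⟩ := hzn
    have := hu.pow n
    rw [hn] at this
    exact not_isUnit_zero this
  · left
    have hreg' : ∀ c ∈ Subring.center A, c ≠ 0 → ∀ x, c * x = 0 → x = 0 := fun c hc hc0 =>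
      (hreg c hc).resolve_left fun h => hz ⟨c, hc, hc0, h⟩
    have hcomm := isCommutativeRing_of_forall_regular hCE hreg'
    have hcen : ∀ a : A, a ∈ Subring.center A := fun a =>
      Subring.mem_center_iff.2 fun b => hcomm b a
    refine ⟨hcomm, ?_⟩
    let _ : CommRing A := { (inferInstance : Ring A) with mul_comm := hcomm }
    have : NoZeroDivisors A := ⟨fun {a b} hab => by
      by_cases ha : a = 0
      · exact Or.inl ha
      · exact Or.inr (hreg' a (hcen a) ha b hab)⟩
    have : IsDomain A := NoZeroDivisors.to_isDomain A
    have : IsNoetherianRing A := hN.elim (fun h => hcomm.isLeftNoetherian h) id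
    exact isDedekindDomain_of_isRightDistributive hd

/-! ### Finite rings -/

section Finite

variable {A : Type*} [Ring A] {p : A}

/-- The nonunits form a two-sided ideal with a finite domain as quotient, a field by Wedderburn. -/
theorem exists_ringHom_finite_field {A : Type u} [Ring A] [Nontrivial A] [Finite A]
    (hA : ∀ a : A, IsNilpotent a ∨ IsUnit a) :
    ∃ (K : Type u) (_ : Field K) (_ : Finite K) (π : A →+* K), ∀ x, π x = 0 ↔ ¬ IsUnit x := by
  have := nonunitsIdeal_isTwoSided hA
  let J := nonunitsIdeal hA
  have hJ : J ≠ ⊤ := fun h => (show (1 : A) ∉ J from fun h => h isUnit_one) (h ▸ Submodule.mem_top)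
  have hπ : ∀ x, Ideal.Quotient.mk J x = 0 ↔ ¬ IsUnit x := fun x =>
    Ideal.Quotient.eq_zero_iff_mem
  have : Nontrivial (A ⧸ J) := Ideal.Quotient.nontrivial_iff.2 hJ
  have : NoZeroDivisors (A ⧸ J) := ⟨fun {a b} hab => by
    obtain ⟨a, rfl⟩ := Ideal.Quotient.mk_surjective a
    obtain ⟨b, rfl⟩ := Ideal.Quotient.mk_surjective b
    rw [← map_mul, hπ] at hab
    rw [hπ, hπ]
    by_contra! h
    exact hab (h.1.mul h.2)⟩
  have : IsDomain (A ⧸ J) := NoZeroDivisors.to_isDomain _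
  have : Finite (A ⧸ J) := Finite.of_surjective _ Ideal.Quotient.mk_surjective
  have hF : IsField (A ⧸ J) := Finite.isDomain_to_isField _
  exact ⟨A ⧸ J, hF.toField, this, Ideal.Quotient.mk J, hπ⟩

/-- Write b p ^ k = p ^ k β. Centrality of p ^ k u gives β u ≡ u b modulo nonunits, and in the
commutative residue field u cancels, so β ≡ b. -/
theorem exists_mul_pow_eq_add {K : Type*} [Field K] {π : A →+* K} (hπ : ∀ x, π x = 0 ↔ ¬ IsUnit x)
    (hr : ∀ x, ¬ IsUnit x → p ∣ x) (hpp : ∀ x, p ∣ x * p) {k : ℕ} {u : A} (hu : IsUnit u)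
    (hz : p ^ k * u ∈ Subring.center A) (hk : p ^ k ≠ 0) (b : A) :
    ∃ w, b * p ^ k = p ^ k * b + p ^ (k + 1) * w := by
  obtain ⟨β, hβ⟩ := exists_mul_pow_eq hpp k b
  have h1 : p ^ k * (β * u - u * b) = 0 := by
    rw [mul_sub, ← mul_assoc, ← mul_assoc, ← hβ, mul_comm_of_mem_center hz, mul_assoc, sub_self]
  have h2 := (hπ _).2 (not_isUnit_of_pow_mul_eq_zero hk h1)
  have h3 : π (β - b) = 0 := by
    have hu' : π u ≠ 0 := fun h => (hπ u).1 h hu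
    rw [map_sub, map_mul, map_mul, mul_comm (π u), ← sub_mul] at h2
    rw [map_sub]
    exact (mul_eq_zero.1 h2).resolve_right hu'
  obtain ⟨w, hw⟩ := hr _ ((hπ _).1 h3)
  exact ⟨w, by rw [hβ, pow_succ, mul_assoc, ← hw, mul_sub]; abel⟩

/-- Central essentiality at p gives central p ^ k u and p ^ (k + 1) u, the latter nonzero. Moving b
across p ^ k and across p ^ (k + 1) preserves its residue, hence so does moving it across p. -/
theorem exists_commutator_generator_eq [Nontrivial A] {K : Type*} [Field K] {π : A →+* K}
    (hπ : ∀ x, π x = 0 ↔ ¬ IsUnit x) (hpn : IsNilpotent p)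
    (hr : ∀ x, ¬ IsUnit x → p ∣ x) (hpp : ∀ x, p ∣ x * p) (hCE : IsCentrallyEssential A) (b : A) :
    p ^ 2 ∣ b * p - p * b := by
  by_cases hp0 : p = 0
  · simp [hp0]
  obtain ⟨c, hc, d, hd, -, hd0, hcd⟩ := hCE p hp0
  obtain ⟨k, u, hu, rfl⟩ := exists_eq_pow_mul_of_dvd hpn hr c
  have hd' : d = p ^ (k + 1) * u := by rw [← hcd, pow_succ', mul_assoc]
  have hk1 : p ^ (k + 1) ≠ 0 := fun h => hd0 (by rw [hd', h, zero_mul])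
  have hk : p ^ k ≠ 0 := fun h => hk1 (by rw [pow_succ, h, zero_mul])
  obtain ⟨w₁, h₁⟩ := exists_mul_pow_eq_add hπ hr hpp hu hc hk b
  obtain ⟨w₂, h₂⟩ := exists_mul_pow_eq_add hπ hr hpp hu (hd' ▸ hd) hk1 b
  obtain ⟨β, hβ⟩ := hpp b
  obtain ⟨w₃, h₃⟩ := hpp w₁
  have h4 : p ^ (k + 1) * (β - (b + p * w₂ - p * w₃)) = 0 := by
    have e : b * p ^ (k + 1) = p ^ (k + 1) * β + p ^ (k + 1) * (p * w₃) := by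
      rw [← h₃, pow_succ, ← mul_assoc, h₁, add_mul, mul_assoc, hβ, pow_succ]
      noncomm_ring
    rw [h₂, pow_succ p (k + 1)] at e
    rw [mul_sub, sub_eq_zero, mul_sub, mul_add, ← mul_assoc, eq_sub_iff_add_eq, ← e]
  have h5 : ¬ IsUnit (β - b) := by
    have h6 := (hπ _).2 (not_isUnit_of_pow_mul_eq_zero hk1 h4)
    have hp' : π p = 0 := (hπ p).2 fun h => by
      obtain ⟨n, hn⟩ := hpn
      exact not_isUnit_zero (hn ▸ h.pow n)
    rw [← hπ]
    simpa [hp'] using h6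
  obtain ⟨w, hw⟩ := hr _ h5
  exact ⟨w, by rw [hβ, ← mul_sub, hw, pow_two, mul_assoc]⟩

theorem pow_succ_dvd_commutator_pow (hpp : ∀ x, p ∣ x * p) {t : A}
    (h : p ^ 2 ∣ t * p - p * t) (i : ℕ) : p ^ (i + 1) ∣ t * p ^ i - p ^ i * t := by
  induction i with
  | zero => simp
  | succ i ih =>
    have e : t * p ^ (i + 1) - p ^ (i + 1) * t =
        (t * p ^ i - p ^ i * t) * p + p ^ i * (t * p - p * t) := by
      rw [pow_succ]; noncomm_ring
    rw [e]
    refine dvd_add ?_ ?_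
    · obtain ⟨y, hy⟩ := ih
      obtain ⟨z, hz⟩ := hpp y
      exact ⟨z, by rw [hy, mul_assoc, hz, pow_succ p (i + 1), mul_assoc]⟩
    · obtain ⟨y, hy⟩ := h
      exact ⟨y, by rw [hy, ← mul_assoc, ← pow_add]⟩

theorem pow_dvd_mul_left (hpp : ∀ x, p ∣ x * p) {i : ℕ} {x : A} (h : p ^ i ∣ x) (a : A) :
    p ^ i ∣ a * x := by
  obtain ⟨y, rfl⟩ := h
  rw [← mul_assoc]
  exact (exists_mul_pow_eq hpp i a).mul_right y

/-- With w = t x - x t, the commutator of t ^ q with x is a sum of q terms t ^ j w t ^ (q - 1 - j).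
As t commutes with w modulo p ^ (i + 2), it is congruent to q t ^ (q - 1) w, and q supplies one more
factor p. -/
theorem pow_succ_dvd_commutator_natPow (hpp : ∀ x, p ∣ x * p) {t : A} (ht : IsUnit t)
    (h : p ^ 2 ∣ t * p - p * t) {q : ℕ} (hq : p ∣ (q : A)) {i : ℕ}
    (hi : ∀ x, p ^ (i + 1) ∣ t * x - x * t) (x : A) : p ^ (i + 2) ∣ t ^ q * x - x * t ^ q := by
  have step : ∀ w, p ^ (i + 1) ∣ w → p ^ (i + 2) ∣ t * w - w * t := by
    rintro _ ⟨y, rfl⟩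
    have e : t * (p ^ (i + 1) * y) - p ^ (i + 1) * y * t =
        (t * p ^ (i + 1) - p ^ (i + 1) * t) * y + p ^ (i + 1) * (t * y - y * t) := by
      noncomm_ring
    rw [e]
    refine dvd_add ((pow_succ_dvd_commutator_pow hpp h (i + 1)).mul_right y) ?_
    obtain ⟨z, hz⟩ := hi y
    exact ⟨p ^ i * z, by rw [hz, pow_succ p (i + 1), pow_succ' p i]; simp only [mul_assoc]⟩
  have step' : ∀ w, p ^ (i + 1) ∣ w → ∀ k, p ^ (i + 2) ∣ t ^ k * w - w * t ^ k := by
    intro w hw k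
    induction k with
    | zero => simp
    | succ k ih =>
      have e : t ^ (k + 1) * w - w * t ^ (k + 1) =
          t * (t ^ k * w - w * t ^ k) + (t * w - w * t) * t ^ k := by
        rw [pow_succ']; noncomm_ring
      rw [e]
      exact dvd_add (pow_dvd_mul_left hpp ih t) ((step w hw).mul_right _)
  set w := t * x - x * t with hw
  -- The extra factor t avoids the exponent k - 1; it is a unit and is cancelled at the end.
  have key : ∀ k : ℕ, p ^ (i + 2) ∣ t * (t ^ k * x - x * t ^ k) - k * (t ^ k * w) := by
    intro k
    induction k with
    | zero => simp
    | succ k ih =>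
      have e : t * (t ^ (k + 1) * x - x * t ^ (k + 1)) - ((k + 1 : ℕ) : A) * (t ^ (k + 1) * w) =
          t * (t * (t ^ k * x - x * t ^ k) - k * (t ^ k * w)) - t * (t ^ k * w - w * t ^ k) := by
        have hc : t * ((k : A) * (t ^ k * w)) = k * (t ^ (k + 1) * w) := by
          rw [← mul_assoc, ← (Nat.cast_commute k t).eq, mul_assoc, ← mul_assoc t, ← pow_succ']
        rw [mul_sub t (t * _), hc, Nat.cast_succ, hw, pow_succ']
        noncomm_ring
      rw [e]
      exact dvd_sub (pow_dvd_mul_left hpp ih t) (pow_dvd_mul_left hpp (step' w (hi x) k) t)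
  have h1 : p ^ (i + 2) ∣ (q : A) * (t ^ q * w) := by
    obtain ⟨y, hy⟩ := pow_dvd_mul_left hpp (hi x) (t ^ q)
    obtain ⟨r, hr⟩ := hq
    rw [hy, ← mul_assoc, (Nat.cast_commute q _).eq, hr, ← mul_assoc, ← pow_succ, mul_assoc]
    exact dvd_mul_right _ _
  have h2 := dvd_add (key q) h1
  rw [sub_add_cancel] at h2
  obtain ⟨v, rfl⟩ := ht
  have h3 := pow_dvd_mul_left hpp h2 (↑v⁻¹ : A)
  rwa [← mul_assoc, Units.inv_mul, one_mul] at h3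

theorem isCommutativeRing_of_finite [Nontrivial A] [Finite A]
    (hA : ∀ a : A, IsNilpotent a ∨ IsUnit a)
    (hp : ¬ IsUnit p) (hr : ∀ x, ¬ IsUnit x → p ∣ x) (hpp : ∀ x, p ∣ x * p)
    (hCE : IsCentrallyEssential A) : IsCommutativeRing A := by
  obtain ⟨K, _, _, π, hπ⟩ := exists_ringHom_finite_field hA
  have hpn := (hA p).resolve_right hp
  have hcom := exists_commutator_generator_eq hπ hpn hr hpp hCE
  obtain ⟨n, hn⟩ := hpn
  have := Fintype.ofFinite K
  set q := Fintype.card K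
  have hq : p ∣ (q : A) := hr _ ((hπ _).1 (by
    rw [map_natCast]; exact FiniteField.cast_card_eq_zero K))
  have hpow : ∀ t, IsUnit t → ∀ m x, p ^ (m + 1) ∣ t ^ q ^ m * x - x * t ^ q ^ m := by
    intro t ht m
    induction m with
    | zero =>
      intro x
      simp only [pow_zero, pow_one, zero_add]
      exact hr _ ((hπ _).1 (by rw [map_sub, map_mul, map_mul, mul_comm, sub_self]))
    | succ m ih =>
      intro x
      rw [pow_succ q, pow_mul]
      exact pow_succ_dvd_commutator_natPow hpp (ht.pow _) (hcom _) hq ih x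
  -- Every residue class has a central representative: x ^ (q ^ n) for a unit x, 0 otherwise.
  have hlift : ∀ x, ∃ c ∈ Subring.center A, ∃ y, x = c + p * y := by
    intro x
    by_cases hx : IsUnit x
    · refine ⟨x ^ q ^ n, Subring.mem_center_iff.2 fun g => ?_, ?_⟩
      · have := hpow x hx n g
        rw [pow_succ, hn, zero_mul, zero_dvd_iff, sub_eq_zero] at this
        exact this.symm
      · obtain ⟨y, hy⟩ := hr (x - x ^ q ^ n) ((hπ _).1 (by
          rw [map_sub, map_pow, FiniteField.pow_card_pow, sub_self]))
        exact ⟨y, by rw [← hy]; abel⟩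
    · obtain ⟨y, hy⟩ := hr x hx
      exact ⟨0, zero_mem _, y, by rw [zero_add, hy]⟩
  -- Removing the central part of x leaves p times a commutator of the same shape, so the
  -- divisibility grows by induction.
  have hpc : ∀ m x, p ^ m ∣ p * x - x * p := by
    intro m
    induction m with
    | zero => simp
    | succ m ih =>
      intro x
      obtain ⟨c, hc, y, rfl⟩ := hlift x
      have e : p * (c + p * y) - (c + p * y) * p = p * (p * y - y * p) := by
        rw [add_mul, mul_comm_of_mem_center hc]; noncomm_ring
      rw [e, pow_succ']
      exact mul_dvd_mul_left p (ih y)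
  have hpcen : ∀ x, p * x = x * p := fun x => by
    have := hpc n x
    rwa [hn, zero_dvd_iff, sub_eq_zero] at this
  have hall : ∀ m x y, p ^ m ∣ x * y - y * x := by
    intro m
    induction m with
    | zero => simp
    | succ m ih =>
      intro x y
      obtain ⟨c, hc, z, rfl⟩ := hlift x
      have e : (c + p * z) * y - y * (c + p * z) = p * (z * y - y * z) := by
        rw [add_mul, mul_comm_of_mem_center hc, mul_add, ← mul_assoc y p, ← hpcen]; noncomm_ring
      rw [e, pow_succ']
      exact mul_dvd_mul_left p (ih z y)
  intro x y
  have := hall n x y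
  rwa [hn, zero_dvd_iff, sub_eq_zero] at this

end Finite

/-! ### Decomposition into indecomposable factors -/

theorem map_mem_center_of_surjective {A B : Type*} [Ring A] [Ring B] {f : A →+* B}
    (hf : Function.Surjective f) {c : A} (hc : c ∈ Subring.center A) : f c ∈ Subring.center B := by
  rw [Subring.mem_center_iff]
  intro b
  obtain ⟨a, rfl⟩ := hf b
  rw [← map_mul, ← map_mul, mul_comm_of_mem_center hc]

/-- A central multiple of an element supported at i is again supported there, so its i-th component
is nonzero. -/
theorem IsCentrallyEssential.of_ringEquiv_pi {A ι : Type*} [Ring A] {R : ι → Type*}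
    [∀ i, Ring (R i)] (hA : IsCentrallyEssential A) (e : A ≃+* ∀ i, R i) (i : ι) :
    IsCentrallyEssential (R i) := by
  classical
  intro a ha
  let f : A →+* R i := (Pi.evalRingHom R i).comp (e : A →+* ∀ i, R i)
  have hf : Function.Surjective f := (Function.surjective_eval i).comp e.surjective
  have hx : e.symm (Pi.single i a) ≠ 0 := by
    rw [Ne, EmbeddingLike.map_eq_zero_iff]
    simpa using ha
  obtain ⟨c, hc, d, hd, -, hd0, h⟩ := hA _ hx
  have hfx : f (e.symm (Pi.single i a)) = a := by simp [f]
  have hac : a * f c = f d := by rw [← h, map_mul, hfx]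
  have hfd : f d ≠ 0 := by
    intro h0
    apply hd0
    rw [← EmbeddingLike.map_eq_zero_iff (f := e)]
    funext j
    by_cases hj : j = i
    · subst hj; exact h0
    · rw [← h, map_mul, RingEquiv.apply_symm_apply, Pi.mul_apply, Pi.single_eq_of_ne hj, zero_mul,
        Pi.zero_apply]
  exact ⟨f c, map_mem_center_of_surjective hf hc, f d, map_mem_center_of_surjective hf hd,
    fun h0 => hfd (by rw [← hac, h0, mul_zero]), hfd, hac⟩

/-- A sum of finitely many pairwise orthogonal primitive idempotents. -/
def IsSumOfPrimitives {A : Type*} [Ring A] (e : A) : Prop :=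
  ∃ s : Finset A, (∀ x ∈ s, x * x = x ∧ x ≠ 0 ∧ ∀ f, f * f = f → f * x = f → f = 0 ∨ f = x) ∧
    (∀ x ∈ s, ∀ y ∈ s, x ≠ y → x * y = 0) ∧ ∑ x ∈ s, x = e

theorem IsSumOfPrimitives.add {A : Type*} [Ring A] {e f : A} (he : IsSumOfPrimitives e)
    (hf : IsSumOfPrimitives f) (hef : e * f = 0) (hfe : f * e = 0) : IsSumOfPrimitives (e + f) := by
  classical
  obtain ⟨s, hs, hso, rfl⟩ := he
  obtain ⟨t, ht, hto, rfl⟩ := hf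
  have hl : ∀ s : Finset A, (∀ x ∈ s, x * x = x) → (∀ x ∈ s, ∀ y ∈ s, x ≠ y → x * y = 0) →
      ∀ x ∈ s, x * ∑ y ∈ s, y = x ∧ (∑ y ∈ s, y) * x = x := by
    intro s hs hso x hx
    rw [Finset.mul_sum, Finset.sum_mul, Finset.sum_eq_single_of_mem x hx fun y hy hyx =>
      hso x hx y hy hyx.symm, Finset.sum_eq_single_of_mem x hx fun y hy hyx => hso y hy x hx hyx]
    exact ⟨hs x hx, hs x hx⟩
  have hls := hl s (fun x hx => (hs x hx).1) hso
  have hlt := hl t (fun x hx => (ht x hx).1) hto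
  have hst : ∀ x ∈ s, ∀ y ∈ t, x * y = 0 ∧ y * x = 0 := by
    intro x hx y hy
    constructor
    · rw [← (hls x hx).1, ← (hlt y hy).2, mul_assoc, ← mul_assoc _ _ y, hef, zero_mul, mul_zero]
    · rw [← (hls x hx).2, ← (hlt y hy).1, mul_assoc, ← mul_assoc _ _ x, hfe, zero_mul, mul_zero]
  have hdisj : Disjoint s t := by
    rw [Finset.disjoint_left]
    intro x hx hx'
    exact (hs x hx).2.1 (by rw [← (hs x hx).1, (hst x hx x hx').1])
  refine ⟨s ∪ t, fun x hx => (Finset.mem_union.1 hx).elim (hs x) (ht x), fun x hx y hy hxy => ?_,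
    Finset.sum_union hdisj⟩
  rcases Finset.mem_union.1 hx with hx | hx <;> rcases Finset.mem_union.1 hy with hy | hy
  · exact hso x hx y hy hxy
  · exact (hst x hx y hy).1
  · exact (hst y hy x hx).2
  · exact hto x hx y hy hxy

theorem exists_not_isSumOfPrimitives {A : Type*} [Ring A] (hCE : IsCentrallyEssential A) {e : A}
    (he : e * e = e) (h : ¬ IsSumOfPrimitives e) :
    ∃ f, f * f = f ∧ f * e = f ∧ f ≠ e ∧ ¬ IsSumOfPrimitives f := by
  have he0 : e ≠ 0 := by
    rintro rfl
    exact h ⟨∅, by simp, by simp, by simp⟩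
  by_contra! hcon
  refine h ⟨{e}, ?_, by simp, by simp⟩
  intro x hx
  rw [Finset.mem_singleton.1 hx]
  refine ⟨he, he0, fun f hf hfe => ?_⟩
  by_contra! hne
  have hef : e * f = f := by
    rw [← mul_comm_of_mem_center (hCE.mem_center_of_isIdempotentElem hf), hfe]
  have hg : (e - f) * (e - f) = e - f := by
    rw [sub_mul, mul_sub, mul_sub, he, hf, hef, hfe]; abel
  have h1 := hcon f hf hfe hne.2
  have h2 := hcon (e - f) hg (by rw [sub_mul, he, hfe]) fun h => hne.1 (by simpa using h)
  apply h
  have := h1.add h2 (by rw [mul_sub, hfe, hf, sub_self]) (by rw [sub_mul, hef, hf, sub_self])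
  rwa [add_sub_cancel] at this

/-- Otherwise idempotents e n descend strictly. The central element 1 - e (n + 1) kills e (n + 1),
hence e n once annihilators are stable, forcing e (n + 1) = e n. -/
theorem isSumOfPrimitives_one {A : Type*} [Ring A] (hCE : IsCentrallyEssential A)
    (hCN : IsCentrallyNoetherian A) : IsSumOfPrimitives (1 : A) := by
  by_contra h1
  choose! f hf hfe hne hnot using fun e (h : e * e = e ∧ ¬ IsSumOfPrimitives (e : A)) =>
    exists_not_isSumOfPrimitives hCE h.1 h.2
  let e : ℕ → A := fun n => f^[n] 1
  have he : ∀ n, e n * e n = e n ∧ ¬ IsSumOfPrimitives (e n) := fun n => by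
    induction n with
    | zero => exact ⟨by simp [e], h1⟩
    | succ n ih =>
      simp only [e, Function.iterate_succ_apply']
      exact ⟨hf _ ih, hnot _ ih⟩
  have hs : ∀ n, e (n + 1) = f (e n) := fun n => by simp only [e, Function.iterate_succ_apply']
  have hle : ∀ n, e n * e (n + 1) = e (n + 1) := fun n => by
    rw [← mul_comm_of_mem_center (hCE.mem_center_of_isIdempotentElem (he (n + 1)).1), hs]
    exact hfe _ (he n)
  obtain ⟨n, hn⟩ := hCN.exists_ann_stable e fun n s _ h => by
    rw [← hle, ← mul_assoc, h, zero_mul]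
  have hc := hCE.mem_center_of_isIdempotentElem (he (n + 1)).1
  have h := hn (n + 1) (1 - e (n + 1)) (sub_mem (one_mem _) hc) (by
    rw [sub_mul, one_mul, (he _).1, sub_self])
  rw [sub_mul, one_mul, mul_comm_of_mem_center hc, hle, sub_eq_zero, hs] at h
  exact hne _ (he n) h.symm

theorem exists_ringEquiv_pi_indecomposable {A : Type u} [Ring A] (hCE : IsCentrallyEssential A)
    (hCN : IsCentrallyNoetherian A) :
    ∃ (n : ℕ) (R : Fin n → Type u) (_ : ∀ i, Ring (R i)),
      (∀ i, Nontrivial (R i) ∧ ∀ e : R i, e * e = e → e = 0 ∨ e = 1) ∧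
      Nonempty (A ≃+* ∀ i, R i) := by
  obtain ⟨s, hs, hso, hsum⟩ := isSumOfPrimitives_one hCE hCN
  let e : Fin s.card → A := fun i => (s.equivFin.symm i).1
  have hmem : ∀ i, e i ∈ s := fun i => (s.equivFin.symm i).2
  have he : CompleteOrthogonalIdempotents e :=
    { idem := fun i => (hs _ (hmem i)).1
      ortho := fun i j hij => hso _ (hmem i) _ (hmem j) fun h =>
        hij (s.equivFin.symm.injective (Subtype.ext h))
      complete := by
        rw [← hsum, ← Finset.sum_coe_sort s]
        exact Equiv.sum_comp s.equivFin.symm fun x : s => x.1 }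
  have hcen : ∀ i, IsMulCentral (e i) := fun i =>
    hCE.mem_center_of_isIdempotentElem (he.idem i)
  refine ⟨s.card, fun i => (he.idem i).Corner, fun i => inferInstance, fun i => ⟨⟨0, 1, ?_⟩, ?_⟩,
    ⟨he.ringEquivOfIsMulCentral hcen⟩⟩
  · intro h
    exact (hs _ (hmem i)).2.1 (congrArg Subtype.val h).symm
  · intro r hr
    have h1 : r.1 * e i = r.1 := congrArg Subtype.val (mul_one r)
    rcases (hs _ (hmem i)).2.2 r.1 (congrArg Subtype.val hr) h1 with h | h
    · exact Or.inl (Subtype.ext h)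
    · exact Or.inr (Subtype.ext h)

/-- A property of indecomposable factors yields a product decomposition. -/
theorem isFiniteProductOf_of_indecomposable {P : ∀ (R : Type u) [Ring R], Prop} {A : Type u}
    [Ring A] (hCE : IsCentrallyEssential A) (hd : IsRightDistributive A)
    (hN : IsRightNoetherian A ∨ IsLeftNoetherian A)
    (hP : ∀ (R : Type u) [Ring R] [Nontrivial R] (f : A →+* R), Function.Surjective f →
      IsCentrallyEssential R → IsRightDistributive R → (IsRightNoetherian R ∨ IsLeftNoetherian R) →
      (∀ e : R, e * e = e → e = 0 ∨ e = 1) → P R) : IsFiniteProductOf P A := by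
  obtain ⟨n, R, _, hR, ⟨e⟩⟩ := exists_ringEquiv_pi_indecomposable hCE
    (hN.elim IsRightNoetherian.isCentrallyNoetherian IsLeftNoetherian.isCentrallyNoetherian)
  refine ⟨n, R, inferInstance, fun i => ⟨(hR i).1, ?_⟩, ⟨e⟩⟩
  have := (hR i).1
  let f : A →+* R i := (Pi.evalRingHom R i).comp (e : A →+* ∀ i, R i)
  have hf : Function.Surjective f := (Function.surjective_eval i).comp e.surjective
  exact hP (R i) f hf (hCE.of_ringEquiv_pi e i) (hd.of_surjective f hf)
    (hN.imp (fun h => h.of_surjective f hf) fun h => h.of_surjective f hf) (hR i).2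

/-! ### The product theorems -/

theorem isProductOfUniserialArtinianOrDedekind {A : Type u} [Ring A]
    (hCE : IsCentrallyEssential A) (hd : IsRightDistributive A)
    (hN : IsRightNoetherian A ∨ IsLeftNoetherian A) :
    IsProductOfUniserialArtinianOrDedekind A := by
  refine isFiniteProductOf_of_indecomposable hCE hd hN fun R _ _ _ _ hCE hd hN hI => ?_
  rcases indecomposable_structure hCE hd hN hI with h | ⟨p, hA, hp, hr, hl, -⟩
  · exact Or.inr h
  · exact Or.inl (isUniserialArtinian_of_generator ((hA p).resolve_right hp) hr hl)

theorem IsCommutativeDedekindDomain.isUniserialRing_of_finite {R : Type*} [Ring R] [Finite R]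
    (h : IsCommutativeDedekindDomain R) : IsUniserialRing R := by
  obtain ⟨hc, hD⟩ := h
  let _ : CommRing R := { (inferInstance : Ring R) with mul_comm := hc }
  have : IsDedekindDomain R := hD
  have hF : IsField R := Finite.isDomain_to_isField R
  have key : ∀ m n : R, (∃ x, m = x * n) ∨ ∃ x, n = x * m := by
    intro m n
    by_cases hm : m = 0
    · exact Or.inl ⟨0, by rw [hm, zero_mul]⟩
    · obtain ⟨b, hb⟩ := hF.mul_inv_cancel hm
      exact Or.inr ⟨n * b, by rw [mul_assoc, mul_comm b, hb, mul_one]⟩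
  refine ⟨isUniserialModule_iff.2 fun m n => ?_, isUniserialModule_iff.2 key⟩
  refine (key m n).imp ?_ ?_
  · rintro ⟨x, hx⟩
    exact ⟨op x, hx.trans (hc _ _)⟩
  · rintro ⟨x, hx⟩
    exact ⟨op x, hx.trans (hc _ _)⟩

theorem isProductOfCommutativeUniserialFinite {A : Type u} [Ring A] [Finite A]
    (hCE : IsCentrallyEssential A) (hd : IsRightDistributive A) :
    IsProductOfCommutativeUniserialFinite A := by
  have hN : IsLeftNoetherian A := (inferInstance : IsNoetherian A A)
  refine isFiniteProductOf_of_indecomposable hCE hd (Or.inr hN)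
    fun R _ _ f hf hCE hd hN hI => ?_
  have hfin : Finite R := Finite.of_surjective f hf
  rcases indecomposable_structure hCE hd hN hI with h | ⟨p, hA, hp, hr, hl, hpp⟩
  · exact ⟨h.1, h.isUniserialRing_of_finite, hfin⟩
  · exact ⟨isCommutativeRing_of_finite hA hp hr hpp hCE,
      (isUniserialArtinian_of_generator ((hA p).resolve_right hp) hr hl).1, hfin⟩

/-! ### A non-commutative uniserial Artinian centrally essential ring -/

/-- Pairs `a₀ + a₁ε` over `K`, multiplied with the cocycle `(a₀, b₀) ↦ δ₁ a₀ * δ₂ b₀`. -/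
@[ext]
structure CocycleExtension {K : Type u} [Field K] (δ₁ δ₂ : Derivation ℤ K K) : Type u where
  fst : K
  snd : K

namespace CocycleExtension

variable {K : Type u} [Field K] {δ₁ δ₂ : Derivation ℤ K K}

instance : Zero (CocycleExtension δ₁ δ₂) := ⟨⟨0, 0⟩⟩
instance : One (CocycleExtension δ₁ δ₂) := ⟨⟨1, 0⟩⟩
instance : Add (CocycleExtension δ₁ δ₂) := ⟨fun a b => ⟨a.fst + b.fst, a.snd + b.snd⟩⟩
instance : Neg (CocycleExtension δ₁ δ₂) := ⟨fun a => ⟨-a.fst, -a.snd⟩⟩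
instance : Mul (CocycleExtension δ₁ δ₂) :=
  ⟨fun a b => ⟨a.fst * b.fst, a.fst * b.snd + a.snd * b.fst + δ₁ a.fst * δ₂ b.fst⟩⟩

@[simp] theorem zero_fst : (0 : CocycleExtension δ₁ δ₂).fst = 0 := rfl
@[simp] theorem zero_snd : (0 : CocycleExtension δ₁ δ₂).snd = 0 := rfl
@[simp] theorem one_fst : (1 : CocycleExtension δ₁ δ₂).fst = 1 := rfl
@[simp] theorem one_snd : (1 : CocycleExtension δ₁ δ₂).snd = 0 := rfl
@[simp] theorem add_fst (a b : CocycleExtension δ₁ δ₂) : (a + b).fst = a.fst + b.fst := rfl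
@[simp] theorem add_snd (a b : CocycleExtension δ₁ δ₂) : (a + b).snd = a.snd + b.snd := rfl
@[simp] theorem neg_fst (a : CocycleExtension δ₁ δ₂) : (-a).fst = -a.fst := rfl
@[simp] theorem neg_snd (a : CocycleExtension δ₁ δ₂) : (-a).snd = -a.snd := rfl
@[simp] theorem mul_fst (a b : CocycleExtension δ₁ δ₂) : (a * b).fst = a.fst * b.fst := rfl
@[simp] theorem mul_snd (a b : CocycleExtension δ₁ δ₂) :
    (a * b).snd = a.fst * b.snd + a.snd * b.fst + δ₁ a.fst * δ₂ b.fst := rfl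

instance : Ring (CocycleExtension δ₁ δ₂) where
  add_assoc a b c := by ext <;> simp [add_assoc]
  zero_add a := by ext <;> simp
  add_zero a := by ext <;> simp
  add_comm a b := by ext <;> simp [add_comm]
  neg_add_cancel a := by ext <;> simp
  left_distrib a b c := by ext <;> simp <;> ring
  right_distrib a b c := by ext <;> simp <;> ring
  zero_mul a := by ext <;> simp
  mul_zero a := by ext <;> simp
  -- This is the 2-cocycle identity for δ₁ a * δ₂ b, which follows from the Leibniz rules.
  mul_assoc a b c := by ext <;> simp <;> ring
  one_mul a := by ext <;> simp
  mul_one a := by ext <;> simp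
  nsmul := nsmulRec
  zsmul := zsmulRec

/-- The generator of the radical. -/
def eps : CocycleExtension δ₁ δ₂ := ⟨0, 1⟩

theorem isUnit_of_fst_ne_zero {a : CocycleExtension δ₁ δ₂} (h : a.fst ≠ 0) : IsUnit a := by
  have hr : ∀ a : CocycleExtension δ₁ δ₂, a.fst ≠ 0 → ∃ b : CocycleExtension δ₁ δ₂,
      b.fst ≠ 0 ∧ a * b = 1 := by
    intro a h
    refine ⟨⟨a.fst⁻¹, -(a.snd * a.fst⁻¹ + δ₁ a.fst * δ₂ a.fst⁻¹) * a.fst⁻¹⟩, inv_ne_zero h, ?_⟩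
    ext
    · simp [h]
    · simp only [mul_snd, one_snd]
      field_simp
      ring
  obtain ⟨b, hb, hab⟩ := hr a h
  obtain ⟨c, -, hbc⟩ := hr b hb
  have : c = a := by rw [← one_mul c, ← hab, mul_assoc, hbc, mul_one]
  exact ⟨⟨a, b, hab, this ▸ hbc⟩, rfl⟩

theorem mem_center_of_fst_eq_zero {a : CocycleExtension δ₁ δ₂} (h : a.fst = 0) :
    a ∈ Subring.center (CocycleExtension δ₁ δ₂) := by
  rw [Subring.mem_center_iff]
  intro g
  ext <;> simp [h, mul_comm]

theorem isCentrallyEssential : IsCentrallyEssential (CocycleExtension δ₁ δ₂) := by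
  intro a ha
  by_cases h : a.fst = 0
  · exact ⟨1, one_mem _, a, mem_center_of_fst_eq_zero h,
      fun h => one_ne_zero (α := K) (congrArg fst h), ha, mul_one a⟩
  · refine ⟨eps, mem_center_of_fst_eq_zero rfl, a * eps, mem_center_of_fst_eq_zero (by simp [eps]),
      fun h => one_ne_zero (α := K) (congrArg snd h), fun h' => h ?_, rfl⟩
    simpa [eps] using congrArg snd h'

theorem eps_mul_eps : (eps * eps : CocycleExtension δ₁ δ₂) = 0 := by ext <;> simp [eps]

theorem eq_eps_mul {a : CocycleExtension δ₁ δ₂} (h : ¬ IsUnit a) :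
    a = eps * ⟨a.snd, 0⟩ ∧ a = ⟨a.snd, 0⟩ * eps := by
  have h0 : a.fst = 0 := by
    by_contra h0
    exact h (isUnit_of_fst_ne_zero h0)
  constructor <;> ext <;> simp [eps, h0]

theorem not_isCommutativeRing {x y : K} (h : δ₁ x * δ₂ y ≠ δ₁ y * δ₂ x) :
    ¬ IsCommutativeRing (CocycleExtension δ₁ δ₂) := by
  intro hc
  have := congrArg snd (hc ⟨x, 0⟩ ⟨y, 0⟩)
  simp at this
  exact h (by simpa using this)

end CocycleExtension

/-- The ring map r ↦ r + δ(r)ε into the dual numbers over K sends nonzero elements to units, so it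
extends to K; its ε-part is the derivation. -/
theorem exists_derivation_extending {R K : Type*} [CommRing R] [IsDomain R] [Field K] [Algebra R K]
    [IsFractionRing R K] (δ : Derivation ℤ R R) : ∃ D : Derivation ℤ K K,
      ∀ r, D (algebraMap R K r) = algebraMap R K (δ r) := by
  let g : R →+* TrivSqZeroExt K K :=
    { toFun := fun r => (algebraMap R K r, algebraMap R K (δ r))
      map_one' := TrivSqZeroExt.ext (map_one _) (by
        change algebraMap R K (δ 1) = 0
        simp)
      map_zero' := TrivSqZeroExt.ext (map_zero _) (by
        change algebraMap R K (δ 0) = 0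
        simp)
      map_add' := fun x y => TrivSqZeroExt.ext (map_add _ _ _) (by
        change algebraMap R K (δ (x + y)) = algebraMap R K (δ x) + algebraMap R K (δ y)
        simp)
      map_mul' := fun x y => TrivSqZeroExt.ext (map_mul _ _ _) (by
        change algebraMap R K (δ (x * y)) =
          algebraMap R K x * algebraMap R K (δ y) + algebraMap R K (δ x) * algebraMap R K y
        simp [mul_comm]) }
  have hg : ∀ y : nonZeroDivisors R, IsUnit (g y) := fun y => by
    rw [TrivSqZeroExt.isUnit_iff_isUnit_fst]
    exact IsLocalization.map_units K y
  let Φ : K →+* TrivSqZeroExt K K := IsLocalization.lift hg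
  have hΦ : ∀ r, Φ (algebraMap R K r) = g r := fun r => IsLocalization.lift_eq hg r
  have hfst : ∀ x, (Φ x).fst = x := by
    have : (TrivSqZeroExt.fstHom K K K : TrivSqZeroExt K K →+* K).comp Φ = RingHom.id K := by
      refine IsLocalization.ringHom_ext (nonZeroDivisors R) (RingHom.ext fun r => ?_)
      change (Φ (algebraMap R K r)).fst = _
      rw [hΦ]
      rfl
    exact fun x => congrArg (fun f : K →+* K => f x) this
  let L : K →+ K :=
    { toFun := fun x => (Φ x).snd
      map_zero' := by simp
      map_add' := fun x y => by simp }
  refine ⟨Derivation.mk' L.toIntLinearMap fun a b => ?_, fun r => ?_⟩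
  · change (Φ (a * b)).snd = a • (Φ b).snd + b • (Φ a).snd
    rw [map_mul, TrivSqZeroExt.snd_mul, hfst, hfst, op_smul_eq_smul]
  · change (Φ (algebraMap R K r)).snd = _
    rw [hΦ]
    rfl

/-- Over ℚ(x, y) with the two partial derivatives, the commutator of x and y is ε; the `ULift` only
adjusts the universe. -/
theorem exists_noncommutative_uniserialArtinian : ∃ (R : Type u) (_ : Ring R),
    IsUniserialArtinian R ∧ IsCentrallyEssential R ∧ ¬ IsCommutativeRing R := by
  let P := MvPolynomial (ULift.{u} Bool) ℚ
  let δ : Bool → Derivation ℤ P P := fun b =>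
    (MvPolynomial.pderiv (R := ℚ) (ULift.up.{u} b)).restrictScalars ℤ
  choose D hD using fun b => exists_derivation_extending (K := FractionRing P) (δ b)
  refine ⟨CocycleExtension (D true) (D false), inferInstance, ?_,
    CocycleExtension.isCentrallyEssential, ?_⟩
  · exact isUniserialArtinian_of_generator (p := CocycleExtension.eps)
      ⟨2, by rw [pow_two, CocycleExtension.eps_mul_eps]⟩
      (fun x hx => ⟨_, (CocycleExtension.eq_eps_mul hx).1⟩)
      fun x hx => ⟨_, (CocycleExtension.eq_eps_mul hx).2⟩
  · refine CocycleExtension.not_isCommutativeRing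
      (x := algebraMap P _ (MvPolynomial.X ⟨true⟩))
      (y := algebraMap P _ (MvPolynomial.X ⟨false⟩)) ?_
    have h : ∀ b c, D b (algebraMap P (FractionRing P) (MvPolynomial.X ⟨c⟩)) =
        if b = c then 1 else 0 := fun b c => by
      refine (hD b _).trans ?_
      change algebraMap P (FractionRing P)
        (MvPolynomial.pderiv (ULift.up.{u} b) (MvPolynomial.X ⟨c⟩)) = _
      rw [MvPolynomial.pderiv_X, Pi.single_apply]
      by_cases hbc : b = c
      · simp [hbc]
      · simp [hbc, Ne.symm hbc]
    rw [h true true, h false false, h true false, h false true]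
    simp

theorem theorem1p2 :
    (∀ (A : Type u) [Ring A] [Nontrivial A],
      (IsRightDistributive A → IsCentrallyEssential A → Finite A →
        IsProductOfCommutativeUniserialFinite A ∧ IsCommutativeRing A ∧ IsDistributiveRing A) ∧
      (IsProductOfCommutativeUniserialFinite A →
        IsCommutativeRing A ∧ IsDistributiveRing A ∧ Finite A)) ∧
    (∀ (A : Type u) [Ring A] [Nontrivial A],
      (IsRightDistributive A → (IsRightNoetherian A ∨ IsLeftNoetherian A) →
        IsCentrallyEssential A →
        IsProductOfUniserialArtinianOrDedekind A ∧
          IsDistributiveRing A ∧ IsTwoSidedNoetherian A) ∧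
      (IsProductOfUniserialArtinianOrDedekind A →
        IsDistributiveRing A ∧ IsTwoSidedNoetherian A)) ∧
    (∃ (R : Type u) (_ : Ring R),
      IsUniserialArtinian R ∧ IsCentrallyEssential R ∧ ¬ IsCommutativeRing R) := by
  refine ⟨fun A _ _ => ⟨fun hd hCE hfin => ?_, fun h => ?_⟩, fun A _ _ => ⟨fun hd hN hCE => ?_,
    fun h => h.isDistributiveRing_and_isTwoSidedNoetherian⟩,
    exists_noncommutative_uniserialArtinian⟩
  · have h := isProductOfCommutativeUniserialFinite hCE hd
    exact ⟨h, h.isCommutativeRing_and_isDistributiveRing.1,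
      h.isCommutativeRing_and_isDistributiveRing.2.1⟩
  · exact h.isCommutativeRing_and_isDistributiveRing
  · have h := isProductOfUniserialArtinianOrDedekind hCE hd hN
    exact ⟨h, h.isDistributiveRing_and_isTwoSidedNoetherian⟩
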